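/- \textbf{Setting.} Let $Z$ and $Y$ be real Banach spaces with $Z\subset Y$ continuously embedded and $Y^*\subset Z^*$ (i.e. restriction of functionals $Y^*\to Z^*$ is injective). Let $\mathcal S^*=(\mathcal S^*_t)_{t\ge 0}$ be a semigroup of bounded linear operators acting on $Y^*$ and on $Z^*$, compatibly with the inclusion $Y^*\subset Z^*$ and strongly continuous for the respective dual norms, such that each $\mathcal S^*_t$ is weak-$*$-to-weak-$*$ continuous on $Y^*$ and on $Z^*$. Let $\mathcal A^*$ be its generator on $Z^*$ and suppose that the pre-adjoint operator $\mathcal A$ of $\mathcal A^*$ generates a strongly continuous semigroup on $Z$. Put $\rho(\lambda)=1+\|\lambda\|_{Y^*}^2$ for $\lambda\in Y^*$. Fix $g\in Y$ and $\nu\in Z^*$ with $$\mathcal S^*_t\nu\in Y^*\quad\text{and}\quad \int_0^t\|\mathcal S^*_s\nu\|_{Y^*}^2\,ds<\infty\qquad\text{for all }t>0 .$$ For $w>0$ and $\lambda_0\in Y^*$, a mild solution of $$d\lambda_t=\mathcal A^*\lambda_t\,dt-w\,\nu\langle g,\lambda_t\rangle\,dt \tag{1}$$ with initial value $\lambda_0$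 is a norm-continuous map $[0,\infty)\to Y^*$, $t\mapsto\lambda_t$, such that $$\lambda_t=\mathcal S^*_t\lambda_0-w\int_0^t\mathcal S^*_{t-s}\nu\,\langle g,\lambda_s\rangle\,ds\qquad\text{for all } t\ge 0 .$$ Let $\mathcal E^w$ be the set of $\lambda_0\in Y^*$ for which the mild solution of (1) satisfies $\langle g,\lambda_t\rangle\ge 0$ for all $t\ge0$, and let $\mathcal E=\bigcap_{w>0}\mathcal E^w$. Assume that $\mathcal S^*_u\nu\in\mathcal E^w$ for all $u>0$ and all $w>0$. For a topological space $X$ with an admissible weight function $\rho:X\to(0,\infty)$ (i.e. all sets $\{\rho\le R\}$, $R>0$, are compact; $(X,\rho)$ is then called a weighted space), $\mathcal B^\rho(X)$ denotes the closure of the bounded continuous functions $C_b(X)$ in the space of functions $f:X\to\mathbb R$ with $\|f\|_\rho=\sup_x |f(x)|/\rho(x)<\infty$. A generalized Feller semigroup on $\mathcal B^\rho(X)$ is a family $(P_t)_{t\ge0}$ of bounded linear operators on $\mathcal B^\rho(X)$ with $P_0=I$, $P_{t+s}=P_tP_s$, $\lim_{t\to0+}P_tf(x)=f(x)$ for all $f$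 and $x$, $\sup_{t\in[0,\varepsilon]}\|P_t\|<\infty$ for some $\varepsilon>0$, and $P_tf\ge0$ whenever $f\ge0$. \textbf{Theorem.} With the weak-$*$-topology on $Y^*$ and $\mathcal E$: \begin{enumerate} \item $\mathcal E$ is a weak-$*$-closed convex cone, $(\mathcal E,\rho)$ is a weighted space, and $\mathcal S^*_t\nu\in\mathcal E$ for all $t>0$. \item For every $w>0$ and every $\lambda_0\in Y^*$, equation (1) has a unique mild solution $(\lambda_t)_{t\ge 0}$; if $\lambda_0\in\mathcal E$, then $\lambda_t\in\mathcal E$ for all $t\ge0$. \item For every $w>0$, $P_tf(\lambda_0):=f(\lambda_t)$, where $(\lambda_t)_{t\ge0}$ is the mild solution of (1) with initial value $\lambda_0\in\mathcal E$, defines a generalized Feller semigroup $(P_t)_{t\ge0}$ on $\mathcal B^\rho(\mathcal E)$. \end{enumerate} -/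

import Mathlib

open Set Filter Topology MeasureTheory

noncomputable section

/-! ### Strongly continuous semigroups -/

/-- A strongly continuous semigroup `(S t)_{t ≥ 0}` of bounded linear operators on a normed space.
Only the values `S t` with `t ≥ 0` matter. -/
structure IsStronglyContinuousSemigroup {V : Type*} [NormedAddCommGroup V] [NormedSpace ℝ V]
    (S : ℝ → V →L[ℝ] V) : Prop where
  zero : S 0 = ContinuousLinearMap.id ℝ V
  add : ∀ s t : ℝ, 0 ≤ s → 0 ≤ t → S (s + t) = (S s).comp (S t)
  strong : ∀ v : V, Tendsto (fun t : ℝ => S t v) (𝓝[>] 0) (𝓝 v)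

/-- `v` is in the domain of the generator of `S`, and the generator maps `v` to `v'`. -/
def GeneratorGraph {V : Type*} [NormedAddCommGroup V] [NormedSpace ℝ V]
    (S : ℝ → V →L[ℝ] V) (v v' : V) : Prop :=
  Tendsto (fun t : ℝ => t⁻¹ • (S t v - v)) (𝓝[>] 0) (𝓝 v')

/-! ### Weighted spaces and generalized Feller semigroups -/

/-- An admissible weight function `ρ : X → (0, ∞)`: all sublevel sets are compact. -/
def IsAdmissibleWeight {X : Type*} [TopologicalSpace X] (ρ : X → Ioi (0 : ℝ)) : Prop :=
  ∀ R : ℝ, 0 < R → IsCompact {x | (ρ x : ℝ) ≤ R}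

/-- The weighted supremum norm `sup_x |f x| / ρ x`. -/
def rhoNorm {X : Type*} (ρ : X → Ioi (0 : ℝ)) (f : X → ℝ) : ℝ := ⨆ x, |f x| / (ρ x : ℝ)

/-- The space `𝓑^ρ(X)`: the functions of finite weighted supremum norm that lie in the closure, for
that norm, of the bounded continuous functions. -/
def Brho {X : Type*} [TopologicalSpace X] (ρ : X → Ioi (0 : ℝ)) : Submodule ℝ (X → ℝ) where
  carrier := {f | (∃ C : ℝ, ∀ x, |f x| ≤ C * (ρ x : ℝ)) ∧
    ∀ ε : ℝ, 0 < ε → ∃ h : BoundedContinuousFunction X ℝ, ∀ x, |f x - h x| ≤ ε * (ρ x : ℝ)}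
  zero_mem' := ⟨⟨0, fun x => by simp⟩, fun ε hε => ⟨0, fun x => by
    simpa using mul_nonneg hε.le (ρ x).2.le⟩⟩
  add_mem' := by
    rintro f₁ f₂ ⟨⟨C₁, b₁⟩, a₁⟩ ⟨⟨C₂, b₂⟩, a₂⟩
    refine ⟨⟨C₁ + C₂, fun x => ?_⟩, fun ε hε => ?_⟩
    · calc |(f₁ + f₂) x| ≤ |f₁ x| + |f₂ x| := abs_add_le _ _
        _ ≤ (C₁ + C₂) * (ρ x : ℝ) := by linarith [b₁ x, b₂ x]
    · obtain ⟨k₁, e₁⟩ := a₁ (ε / 2) (by positivity)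
      obtain ⟨k₂, e₂⟩ := a₂ (ε / 2) (by positivity)
      refine ⟨k₁ + k₂, fun x => ?_⟩
      calc |(f₁ + f₂) x - (k₁ + k₂) x| = |(f₁ x - k₁ x) + (f₂ x - k₂ x)| := by
            congr 1; simp; ring
        _ ≤ |f₁ x - k₁ x| + |f₂ x - k₂ x| := abs_add_le _ _
        _ ≤ ε * (ρ x : ℝ) := by linarith [e₁ x, e₂ x]
  smul_mem' := by
    rintro c f ⟨⟨C, b⟩, a⟩
    refine ⟨⟨|c| * C, fun x => ?_⟩, fun ε hε => ?_⟩
    · simpa [abs_mul, mul_assoc] using mul_le_mul_of_nonneg_left (b x) (abs_nonneg c)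
    · have hc : 0 < |c| + 1 := by positivity
      obtain ⟨k, e⟩ := a (ε / (|c| + 1)) (by positivity)
      refine ⟨c • k, fun x => ?_⟩
      have hρ : 0 < (ρ x : ℝ) := (ρ x).2
      calc |(c • f) x - (c • k) x| = |c| * |f x - k x| := by
            rw [← abs_mul]; congr 1; simp; ring
        _ ≤ (|c| + 1) * (ε / (|c| + 1) * (ρ x : ℝ)) :=
            mul_le_mul (by linarith) (e x) (abs_nonneg _) hc.le
        _ = ε * (ρ x : ℝ) := by field_simp

/-- A generalized Feller semigroup on `𝓑^ρ(X)`. Only the values `P t` with `t ≥ 0` matter. -/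
structure IsGeneralizedFellerSemigroup {X : Type*} [TopologicalSpace X] (ρ : X → Ioi (0 : ℝ))
    (P : ℝ → Brho ρ →ₗ[ℝ] Brho ρ) : Prop where
  bounded : ∀ t : ℝ, 0 ≤ t → ∃ C : ℝ, ∀ f : Brho ρ, rhoNorm ρ (P t f) ≤ C * rhoNorm ρ f
  zero : P 0 = LinearMap.id
  add : ∀ s t : ℝ, 0 ≤ s → 0 ≤ t → P (t + s) = (P t).comp (P s)
  pointwise : ∀ (f : Brho ρ) (x : X),
    Tendsto (fun t : ℝ => (P t f : X → ℝ) x) (𝓝[>] 0) (𝓝 ((f : X → ℝ) x))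
  locally_bounded : ∃ C ε : ℝ, 0 < ε ∧ ∀ t : ℝ, 0 ≤ t → t ≤ ε →
    ∀ f : Brho ρ, rhoNorm ρ (P t f) ≤ C * rhoNorm ρ f
  positive : ∀ t : ℝ, 0 ≤ t → ∀ f : Brho ρ,
    (∀ x, 0 ≤ (f : X → ℝ) x) → ∀ x, 0 ≤ (P t f : X → ℝ) x

/-! ### The lift setting -/

section Lift

variable {Z Y : Type*} [NormedAddCommGroup Z] [NormedSpace ℝ Z]
  [NormedAddCommGroup Y] [NormedSpace ℝ Y]

/-- The map `Y* → Z*` dual to the embedding `ι : Z → Y` (restriction of functionals to `Z`). -/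
def dualRestrict (ι : Z →L[ℝ] Y) (l : StrongDual ℝ Y) : StrongDual ℝ Z := l.comp ι

/-- The standing conditions on `Z ⊂ Y` (embedding `ι`), `Y* ⊂ Z*`, and on the semigroup `S*`, whose
action on `Y*` is `SY` and whose action on `Z*` is `SZ`. -/
structure IsLiftSetting (ι : Z →L[ℝ] Y) (SY : ℝ → StrongDual ℝ Y →L[ℝ] StrongDual ℝ Y)
    (SZ : ℝ → StrongDual ℝ Z →L[ℝ] StrongDual ℝ Z) : Prop where
  embedding : Function.Injective ι
  dual_embedding : Function.Injective (dualRestrict ι)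
  compatible : ∀ t : ℝ, 0 ≤ t → ∀ l : StrongDual ℝ Y,
    dualRestrict ι (SY t l) = SZ t (dualRestrict ι l)
  semigroupY : IsStronglyContinuousSemigroup SY
  semigroupZ : IsStronglyContinuousSemigroup SZ
  weakStarY : ∀ t : ℝ, 0 ≤ t → Continuous fun l : WeakDual ℝ Y =>
    StrongDual.toWeakDual (SY t (WeakDual.toStrongDual l))
  weakStarZ : ∀ t : ℝ, 0 ≤ t → Continuous fun l : WeakDual ℝ Z =>
    StrongDual.toWeakDual (SZ t (WeakDual.toStrongDual l))
  /-- The pre-adjoint of the generator of `S*` generates a strongly continuous semigroup on `Z`. -/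
  preadjoint : ∃ S : ℝ → Z →L[ℝ] Z, IsStronglyContinuousSemigroup S ∧
    ∀ z z' : Z, GeneratorGraph S z z' ↔
      ∀ l l' : StrongDual ℝ Z, GeneratorGraph SZ l l' → l' z = l z'

/-- `S*_t ν`, for `ν ∈ Z*`, as an element of `Y*`; meaningful if `S*_t ν` lies in `Y* ⊂ Z*`. -/
def damped (ι : Z →L[ℝ] Y) (SZ : ℝ → StrongDual ℝ Z →L[ℝ] StrongDual ℝ Z) (ν : StrongDual ℝ Z)
    (t : ℝ) : StrongDual ℝ Y :=
  Function.invFun (dualRestrict ι) (SZ t ν)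

/-- The regularity condition: `S*_t ν ∈ Y*` for `t > 0`, and `∫_0^t ‖S*_s ν‖²_{Y*} ds < ∞`. -/
structure IsRegularizing (ι : Z →L[ℝ] Y) (SZ : ℝ → StrongDual ℝ Z →L[ℝ] StrongDual ℝ Z)
    (ν : StrongDual ℝ Z) : Prop where
  mem : ∀ t : ℝ, 0 < t → ∃ l : StrongDual ℝ Y, dualRestrict ι l = SZ t ν
  sq_integrable : ∀ t : ℝ, 0 < t →
    IntegrableOn (fun s : ℝ => ‖damped ι SZ ν s‖ ^ 2) (Ioc 0 t) volume

/-- `l` is a (continuous, `Y*`-valued) mild solution of `dλ = A* λ dt - w ν ⟨g, λ⟩ dt`, `λ_0 = l₀`: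
`λ_t = S*_t λ_0 - w ∫_0^t S*_{t-s} ν ⟨g, λ_s⟩ ds` for `t ≥ 0`. -/
structure IsMildSolution (ι : Z →L[ℝ] Y) (SY : ℝ → StrongDual ℝ Y →L[ℝ] StrongDual ℝ Y)
    (SZ : ℝ → StrongDual ℝ Z →L[ℝ] StrongDual ℝ Z) (ν : StrongDual ℝ Z) (g : Y) (w : ℝ)
    (l₀ : StrongDual ℝ Y) (l : ℝ → StrongDual ℝ Y) : Prop where
  continuousOn : ContinuousOn l (Ici 0)
  integrable : ∀ t : ℝ, 0 ≤ t →
    IntervalIntegrable (fun s : ℝ => l s g • damped ι SZ ν (t - s)) volume 0 t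
  eq : ∀ t : ℝ, 0 ≤ t →
    l t = SY t l₀ - w • ∫ s in (0 : ℝ)..t, l s g • damped ι SZ ν (t - s)

/-- The cone `𝓔^w ⊂ Y*` of initial values for which the mild solution has `⟨g, λ_t⟩ ≥ 0` for all
`t ≥ 0`. -/
def coneEw (ι : Z →L[ℝ] Y) (SY : ℝ → StrongDual ℝ Y →L[ℝ] StrongDual ℝ Y)
    (SZ : ℝ → StrongDual ℝ Z →L[ℝ] StrongDual ℝ Z) (ν : StrongDual ℝ Z) (g : Y) (w : ℝ) :
    Set (WeakDual ℝ Y) :=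
  {l₀ | ∃ l : ℝ → StrongDual ℝ Y,
    IsMildSolution ι SY SZ ν g w (WeakDual.toStrongDual l₀) l ∧ ∀ t : ℝ, 0 ≤ t → 0 ≤ l t g}

/-- The cone `𝓔 = ⋂_{w > 0} 𝓔^w`, as a subset of `Y*` with the weak-* topology. -/
def coneE (ι : Z →L[ℝ] Y) (SY : ℝ → StrongDual ℝ Y →L[ℝ] StrongDual ℝ Y)
    (SZ : ℝ → StrongDual ℝ Z →L[ℝ] StrongDual ℝ Z) (ν : StrongDual ℝ Z) (g : Y) :
    Set (WeakDual ℝ Y) :=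
  ⋂ w ∈ Ioi (0 : ℝ), coneEw ι SY SZ ν g w

/-- The weight `ρ(λ) = 1 + ‖λ‖²_{Y*}` on a subset of `Y*`. -/
def weight (E : Set (WeakDual ℝ Y)) (l : E) : Ioi (0 : ℝ) :=
  ⟨1 + ‖WeakDual.toStrongDual (l : WeakDual ℝ Y)‖ ^ 2, by
    have : 0 < 1 + ‖WeakDual.toStrongDual (l : WeakDual ℝ Y)‖ ^ 2 := by positivity
    exact this⟩

end Lift

end

/-! Everything is moved to the pre-dual `Y`. Weak-* continuity makes each `SY t` the adjoint of an
operator `T t` on `Y`, and `T`, being weakly continuous and locally bounded, is a strongly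
continuous semigroup. The curve `D t = S*_t ν` is locally integrable in `Y*`, so the dual Volterra
equation `G_t = T_t g - w ∫_0^t ⟨g, D_{t-s}⟩ G_s ds` has a solution in `Y`. The identity `⟨g, λ_t⟩ =
λ_0(G_t)` (`mildFlow_apply_self`) then gives the mild solution in closed form (`mildFlow`), linear
and weak-* continuous in `λ_0`. Uniqueness comes from the scalar Volterra equation for `⟨g, λ_t⟩`.

By the same identity `𝓔^w` is the intersection of the half-spaces `{λ | 0 ≤ λ(G_t)}`
(`mem_coneEw_iff`), hence a closed convex cone, and the flow property makes it invariant under its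
own flow.

The invariance of `𝓔` under the flow of one `w` requires a comparison of coefficients. Formally
`λ^w_t = λ^{w'}_t + (w' - w) ∫_0^t ⟨g, λ^w_s⟩ Φ^{w'}_{t-s} ν ds`, with `Φ^{w'}` the flow for `w'`.
Since `ν` need not lie in `Y*`, it is replaced by `D u` and `u → 0+`
(`tendsto_mildFlow_comparison`). If `w ≤ w'`, the right side is a sum of elements of `𝓔^{w'}`; if
`w' ≤ w`, the formula evaluated at `g` gives `𝓔^w ⊆ 𝓔^{w'}`.

Finally, a continuous flow with `ρ(λ_t) ≤ C ρ(λ_0)` locally uniformly in time acts on `𝓑^ρ` by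
composition (`exists_generalizedFellerSemigroup_of_flow`); Banach–Alaoglu makes `ρ` admissible. -/

/-! ### Strongly continuous semigroups: local bounds and continuity of orbits -/

namespace IsStronglyContinuousSemigroup

variable {V : Type*} [NormedAddCommGroup V] [NormedSpace ℝ V] {S : ℝ → V →L[ℝ] V}

theorem add_apply (hS : IsStronglyContinuousSemigroup S) {s t : ℝ} (hs : 0 ≤ s) (ht : 0 ≤ t)
    (v : V) : S (s + t) v = S s (S t v) := by
  rw [hS.add s t hs ht]; rfl

theorem zero_apply (hS : IsStronglyContinuousSemigroup S) (v : V) : S 0 v = v := by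
  rw [hS.zero]; rfl

/-- Otherwise some `t n → 0+` has `‖S (t n)‖ > n`, although every orbit converges along `t n`; this
contradicts Banach–Steinhaus. -/
theorem exists_bound_near_zero [CompleteSpace V] (hS : IsStronglyContinuousSemigroup S) :
    ∃ δ > 0, ∃ M : ℝ, ∀ t ∈ Icc (0 : ℝ) δ, ‖S t‖ ≤ M := by
  by_contra! H
  -- The maximum with `‖S 0‖` forces `t n ≠ 0`: strong convergence is only assumed along `𝓝[>] 0`.
  have H' : ∀ n : ℕ, ∃ t ∈ Icc (0 : ℝ) (1 / ((n : ℝ) + 1)), max (n : ℝ) ‖S 0‖ < ‖S t‖ :=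
    fun n => H _ (by positivity) _
  choose t ht hlt using H'
  have hpos : ∀ n, t n ∈ Ioi (0 : ℝ) := fun n => by
    rcases (ht n).1.eq_or_lt with h | h
    · have := (le_max_right (n : ℝ) ‖S 0‖).trans_lt (hlt n)
      rw [← h] at this
      exact absurd this (lt_irrefl _)
    · exact h
  have htend : Tendsto t atTop (𝓝[>] 0) := by
    refine tendsto_nhdsWithin_iff.2 ⟨?_, Eventually.of_forall hpos⟩
    exact squeeze_zero (fun n => (ht n).1) (fun n => (ht n).2)
      tendsto_one_div_add_atTop_nhds_zero_nat
  obtain ⟨C, hC⟩ := banach_steinhaus (g := fun n => S (t n)) fun v => by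
    obtain ⟨C, hC⟩ := ((hS.strong v).comp htend).norm.bddAbove_range
    exact ⟨C, fun n => hC ⟨n, rfl⟩⟩
  obtain ⟨n, hn⟩ := exists_nat_gt C
  linarith [hC n, hlt n, le_max_left (n : ℝ) ‖S 0‖]

theorem exists_bound [CompleteSpace V] (hS : IsStronglyContinuousSemigroup S) (T : ℝ) :
    ∃ M : ℝ, 0 ≤ M ∧ ∀ t ∈ Icc (0 : ℝ) T, ‖S t‖ ≤ M := by
  obtain ⟨δ, hδ, M, hM⟩ := hS.exists_bound_near_zero
  have key : ∀ n : ℕ, ∃ M : ℝ, ∀ t ∈ Icc (0 : ℝ) (n * δ), ‖S t‖ ≤ M := by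
    intro n
    induction n with
    | zero =>
      refine ⟨‖S 0‖, fun t ht => ?_⟩
      have : t = 0 := le_antisymm (by simpa using ht.2) ht.1
      rw [this]
    | succ n ih =>
      obtain ⟨K, hK⟩ := ih
      refine ⟨max M (M * K), fun t ht => ?_⟩
      rcases le_total t δ with h | h
      · exact (hM t ⟨ht.1, h⟩).trans (le_max_left _ _)
      · have h1 : S t = (S δ).comp (S (t - δ)) := by
          rw [← hS.add δ (t - δ) hδ.le (by linarith)]; congr 1; ring
        have h2 : t - δ ∈ Icc (0 : ℝ) (n * δ) :=
          ⟨by linarith, by have := ht.2; push_cast at this; linarith⟩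
        have h3 := hM δ ⟨hδ.le, le_rfl⟩
        calc ‖S t‖ ≤ ‖S δ‖ * ‖S (t - δ)‖ := by
              rw [h1]; exact ContinuousLinearMap.opNorm_comp_le _ _
          _ ≤ M * K := mul_le_mul h3 (hK _ h2) (norm_nonneg _) ((norm_nonneg _).trans h3)
          _ ≤ _ := le_max_right _ _
  obtain ⟨n, hn⟩ := exists_nat_ge (T / δ)
  obtain ⟨K, hK⟩ := key n
  refine ⟨max K 0, le_max_right _ _, fun t ht => (hK t ⟨ht.1, ht.2.trans ?_⟩).trans
    (le_max_left _ _)⟩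
  rwa [div_le_iff₀ hδ] at hn

theorem norm_apply_sub_le (hS : IsStronglyContinuousSemigroup S) {M s t : ℝ}
    (hs : 0 ≤ s) (hst : s ≤ t) (hM : ‖S s‖ ≤ M) (v : V) :
    ‖S t v - S s v‖ ≤ M * ‖S (t - s) v - v‖ := by
  have : S t v = S s (S (t - s) v) := by
    rw [← hS.add_apply hs (by linarith)]; congr 2; ring
  rw [this, ← map_sub]
  exact (S s).le_of_opNorm_le hM _

theorem tendsto_nhdsGE (hS : IsStronglyContinuousSemigroup S) (v : V) :
    Tendsto (fun t => S t v) (𝓝[≥] 0) (𝓝 v) := by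
  have h : ContinuousWithinAt (fun t => S t v) (Ioi 0) 0 := by
    simpa [ContinuousWithinAt, hS.zero_apply] using hS.strong v
  have h2 := continuousWithinAt_Ioi_iff_Ici.1 h
  simpa [ContinuousWithinAt, hS.zero_apply] using h2

/-- Factoring out the operator at the smaller time bounds increments on either side by `M * ‖S |s -
t| v - v‖`, so right continuity at `0` suffices. -/
theorem continuousOn_orbit [CompleteSpace V] (hS : IsStronglyContinuousSemigroup S) (v : V) :
    ContinuousOn (fun t => S t v) (Ici 0) := by
  intro t ht
  obtain ⟨M, hM0, hM⟩ := hS.exists_bound (t + 1)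
  have h0 : Tendsto (fun s : ℝ => |s - t|) (𝓝[Ici 0] t) (𝓝[≥] 0) := by
    refine tendsto_nhdsWithin_iff.2 ⟨?_, Eventually.of_forall fun s => mem_Ici.2 (abs_nonneg _)⟩
    have : Tendsto (fun s : ℝ => |s - t|) (𝓝 t) (𝓝 |t - t|) := by
      apply Continuous.tendsto; fun_prop
    simpa using this.mono_left nhdsWithin_le_nhds
  have h1 : Tendsto (fun s : ℝ => M * ‖S |s - t| v - v‖) (𝓝[Ici 0] t) (𝓝 0) := by
    have := (((hS.tendsto_nhdsGE v).comp h0).sub_const v).norm.const_mul M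
    simpa using this
  rw [ContinuousWithinAt, tendsto_iff_norm_sub_tendsto_zero]
  refine squeeze_zero' (Eventually.of_forall fun s => norm_nonneg _) ?_ h1
  filter_upwards [self_mem_nhdsWithin, nhdsWithin_le_nhds (Iio_mem_nhds (lt_add_one t))]
    with s hs hs1
  rcases le_total s t with h | h
  · rw [norm_sub_rev, abs_sub_comm, abs_of_nonneg (by linarith)]
    exact hS.norm_apply_sub_le hs h (hM s ⟨hs, le_of_lt hs1⟩) v
  · rw [abs_of_nonneg (by linarith)]
    exact hS.norm_apply_sub_le ht h (hM t ⟨ht, by linarith⟩) v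

end IsStronglyContinuousSemigroup

/-! ### Weakly continuous semigroups are strongly continuous -/

section Weak

variable {V : Type*} [NormedAddCommGroup V] [NormedSpace ℝ V]

/-- A point outside a closed subspace is separated from it by a functional that vanishes on it. -/
theorem Submodule.exists_strongDual_eq_zero_of_notMem {p : Submodule ℝ V}
    (hp : IsClosed (p : Set V)) {v : V} (hv : v ∉ p) :
    ∃ l : StrongDual ℝ V, (∀ x ∈ p, l x = 0) ∧ l v ≠ 0 := by
  obtain ⟨l, u, h1, h2⟩ := geometric_hahn_banach_closed_point p.convex hp hv
  have hl : ∀ x ∈ p, l x = 0 := by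
    intro x hx
    by_contra hne
    have := h1 (((u + 1) / l x) • x) (p.smul_mem _ hx)
    rw [map_smul, smul_eq_mul, div_mul_cancel₀ _ hne] at this
    linarith
  refine ⟨l, hl, fun h => ?_⟩
  have := h1 0 p.zero_mem
  rw [map_zero] at this
  linarith

/-- A functional that vanishes on the values at rational times vanishes along the whole curve by
density, so by Hahn–Banach no value leaves their closed span. -/
theorem separableSpace_range_of_weakly_continuous {f : ℝ → V}
    (hf : ∀ l : StrongDual ℝ V, Continuous fun t => l (f t)) :
    TopologicalSpace.IsSeparable (range f) := by
  set p : Submodule ℝ V := (Submodule.span ℝ (range fun q : ℚ => f q)).topologicalClosure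
  have hp : TopologicalSpace.IsSeparable (p : Set V) := by
    have : TopologicalSpace.IsSeparable
        ((Submodule.span ℝ (range fun q : ℚ => f q) : Submodule ℝ V) : Set V) :=
      ((countable_range _).isSeparable).span
    simpa [p, Submodule.topologicalClosure_coe] using this.closure
  refine hp.mono ?_
  rintro _ ⟨t, rfl⟩
  by_contra ht
  obtain ⟨l, hl, hne⟩ := Submodule.exists_strongDual_eq_zero_of_notMem
    (Submodule.isClosed_topologicalClosure _) ht
  refine hne ?_
  have : (fun t => l (f t)) = fun _ => 0 := by
    refine Rat.denseRange_cast.equalizer (hf l) continuous_const ?_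
    funext q
    exact hl _ (Submodule.le_topologicalClosure _ (Submodule.subset_span ⟨q, rfl⟩))
  exact congrFun this t

/-- A weakly continuous function on the line is strongly measurable. -/
theorem stronglyMeasurable_of_weakly_continuous {f : ℝ → V}
    (hf : ∀ l : StrongDual ℝ V, Continuous fun t => l (f t)) : StronglyMeasurable f := by
  borelize V
  have hsep := separableSpace_range_of_weakly_continuous hf
  refine stronglyMeasurable_iff_measurable_separable.2 ⟨?_, hsep⟩
  -- By Hahn–Banach a closed ball is cut out by inequalities on functionals, so its preimage is
  -- closed.
  have hball : ∀ (v : V) (r : ℝ), 0 ≤ r → IsClosed (f ⁻¹' Metric.closedBall v r) := by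
    intro v r hr
    have : f ⁻¹' Metric.closedBall v r =
        ⋂ l : StrongDual ℝ V, {t | ‖l (f t) - l v‖ ≤ r * ‖l‖} := by
      ext t
      simp only [mem_preimage, Metric.mem_closedBall, dist_eq_norm, mem_iInter, mem_ofPred_eq]
      constructor
      · intro h l
        rw [← map_sub, mul_comm]
        exact l.le_opNorm_of_le h
      · intro h
        refine NormedSpace.norm_le_dual_bound ℝ _ hr fun l => ?_
        rw [map_sub]; exact h l
    rw [this]
    exact isClosed_iInter fun l =>
      isClosed_le (((hf l).sub continuous_const).norm) continuous_const
  refine measurable_of_isOpen fun U hU => ?_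
  obtain ⟨c, hc, hcl⟩ := hsep
  -- Separability of the range lets countably many closed balls, with centres in `c` and rational
  -- radii, replace the open set.
  have : f ⁻¹' U = ⋃ x ∈ c, ⋃ q ∈ {q : ℚ | 0 ≤ q ∧ Metric.closedBall x (q : ℝ) ⊆ U},
      f ⁻¹' Metric.closedBall x (q : ℝ) := by
    ext t
    simp only [mem_preimage, mem_iUnion, mem_ofPred_eq, exists_prop]
    constructor
    · intro ht
      obtain ⟨ε, hε, hb⟩ := Metric.isOpen_iff.1 hU _ ht
      obtain ⟨q, hq0, hq⟩ := exists_rat_btwn (show (0 : ℝ) < ε / 2 by positivity)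
      obtain ⟨x, hx, hxd⟩ := Metric.mem_closure_iff.1 (hcl (mem_range_self t)) q hq0
      refine ⟨x, hx, q, ⟨by exact_mod_cast hq0.le, fun y hy => hb ?_⟩, hxd.le⟩
      have h1 : dist y (f t) ≤ dist y x + dist x (f t) := dist_triangle _ _ _
      rw [Metric.mem_closedBall] at hy
      rw [dist_comm] at hxd
      rw [Metric.mem_ball]; linarith
    · rintro ⟨x, -, q, ⟨-, hq⟩, ht⟩
      exact hq ht
  rw [this]
  exact MeasurableSet.biUnion hc fun x _ =>
    MeasurableSet.biUnion (to_countable _) fun q hq =>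
      (hball x q (by exact_mod_cast hq.1)).measurableSet

/-- A semigroup of bounded operators which is weakly continuous and locally bounded is strongly
continuous. -/
theorem isStronglyContinuousSemigroup_of_weak [CompleteSpace V] {T : ℝ → V →L[ℝ] V}
    (zero : T 0 = ContinuousLinearMap.id ℝ V)
    (add : ∀ s t : ℝ, 0 ≤ s → 0 ≤ t → T (s + t) = (T s).comp (T t))
    (weak : ∀ (l : StrongDual ℝ V) (v : V), ContinuousOn (fun t => l (T t v)) (Ici 0))
    (bound : ∀ a : ℝ, ∃ M : ℝ, 0 ≤ M ∧ ∀ t ∈ Icc (0 : ℝ) a, ‖T t‖ ≤ M) :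
    IsStronglyContinuousSemigroup T := by
  refine ⟨zero, add, fun v => ?_⟩
  obtain ⟨M, hM0, hM⟩ := bound 1
  have hev : ∀ᶠ t : ℝ in 𝓝[>] 0, t ∈ Icc (0 : ℝ) 1 :=
    mem_of_superset (Ioc_mem_nhdsGT one_pos) Ioc_subset_Icc_self
  -- The vectors with strongly convergent orbit form a closed subspace. A functional that vanishes
  -- on it will be shown to vanish at `v` as well.
  let X : Submodule ℝ V :=
    { carrier := {v | Tendsto (fun t : ℝ => T t v) (𝓝[>] 0) (𝓝 v)}
      zero_mem' := by simp
      add_mem' := fun {x y} hx hy => by simpa using Tendsto.add hx hy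
      smul_mem' := fun c x hx => by simpa using Tendsto.const_smul hx c }
  have hX : IsClosed (X : Set V) := by
    refine isClosed_of_closure_subset fun x hx => ?_
    change Tendsto (fun t : ℝ => T t x) (𝓝[>] 0) (𝓝 x)
    rw [Metric.tendsto_nhds]
    intro ε hε
    obtain ⟨y, hy, hxy⟩ := Metric.mem_closure_iff.1 hx (ε / (2 * (M + 1))) (by positivity)
    have hy' : Tendsto (fun t : ℝ => T t y) (𝓝[>] 0) (𝓝 y) := hy
    filter_upwards [hev, (Metric.tendsto_nhds.1 hy') (ε / 2) (by positivity)] with t ht h1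
    rw [dist_eq_norm] at hxy h1 ⊢
    have h2 : ‖T t (x - y)‖ ≤ M * ‖x - y‖ := (T t).le_of_opNorm_le (hM t ht) _
    have h3 : T t x - x = T t (x - y) + (T t y - y) - (x - y) := by
      rw [map_sub]; abel
    have h4 : (M + 1) * ‖x - y‖ < ε / 2 := by
      calc (M + 1) * ‖x - y‖ < (M + 1) * (ε / (2 * (M + 1))) := by gcongr
        _ = ε / 2 := by field_simp
    calc ‖T t x - x‖ ≤ ‖T t (x - y)‖ + ‖T t y - y‖ + ‖x - y‖ := by
          rw [h3]; exact (norm_sub_le _ _).trans (by gcongr; exact norm_add_le _ _)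
      _ < ε := by linarith
  by_contra hv
  obtain ⟨l, hl, hne⟩ := Submodule.exists_strongDual_eq_zero_of_notMem (p := X) hX (v := v) hv
  have hmax : ∀ l : StrongDual ℝ V, Continuous fun t : ℝ => l (T (max t 0) v) := fun l =>
    (weak l v).comp_continuous (by fun_prop) fun t => mem_Ici.2 (le_max_right _ _)
  have hmeas : StronglyMeasurable fun t : ℝ => T (max t 0) v :=
    stronglyMeasurable_of_weakly_continuous hmax
  have hint : ∀ a b : ℝ, IntervalIntegrable (fun t : ℝ => T (max t 0) v) volume a b := by
    intro a b
    obtain ⟨K, hK0, hK⟩ := bound (max (max a b) 0)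
    refine (intervalIntegrable_const (c := K * ‖v‖)).mono_fun hmeas.aestronglyMeasurable ?_
    refine (ae_restrict_mem measurableSet_uIoc).mono fun t ht => ?_
    rw [Real.norm_of_nonneg (by positivity)]
    refine (T _).le_of_opNorm_le (hK _ ⟨le_max_right _ _, max_le_max ht.2 le_rfl⟩) _
  -- Averages of the orbit lie in `X`: applying `T t` shifts the window of integration, which
  -- changes the integral only by two pieces of length `t`.
  have hz : ∀ ε : ℝ, 0 < ε → (∫ s in (0 : ℝ)..ε, T (max s 0) v) ∈ X := by
    intro ε hε
    obtain ⟨K, hK0, hK⟩ := bound (ε + 1)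
    change Tendsto _ _ _
    rw [tendsto_iff_norm_sub_tendsto_zero]
    have hlim : Tendsto (fun t : ℝ => 2 * (K * ‖v‖ * t)) (𝓝[>] 0) (𝓝 0) := by
      have : Tendsto (fun t : ℝ => 2 * (K * ‖v‖ * t)) (𝓝 0) (𝓝 (2 * (K * ‖v‖ * 0))) := by
        apply Continuous.tendsto; fun_prop
      simpa using this.mono_left nhdsWithin_le_nhds
    refine squeeze_zero' (Eventually.of_forall fun _ => norm_nonneg _) ?_ hlim
    filter_upwards [hev] with t ht
    have h1 : T t (∫ s in (0 : ℝ)..ε, T (max s 0) v) = ∫ s in t..(ε + t), T (max s 0) v := by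
      rw [← (T t).intervalIntegral_comp_comm (hint _ _)]
      have := intervalIntegral.integral_comp_add_right (a := 0) (b := ε)
        (fun s => T (max s 0) v) t
      rw [zero_add] at this
      rw [← this]
      refine intervalIntegral.integral_congr fun s hs => ?_
      rw [uIcc_of_le hε.le] at hs
      have e : max (s + t) 0 = t + max s 0 := by
        rw [max_eq_left hs.1, max_eq_left (by linarith [hs.1, ht.1]), add_comm]
      rw [e, add _ _ ht.1 (le_max_right _ _)]; rfl
    have h2 : (∫ s in t..(ε + t), T (max s 0) v) - ∫ s in (0 : ℝ)..ε, T (max s 0) v =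
        (∫ s in ε..(ε + t), T (max s 0) v) - ∫ s in (0 : ℝ)..t, T (max s 0) v := by
      have e1 := intervalIntegral.integral_add_adjacent_intervals (hint 0 t) (hint t (ε + t))
      have e2 := intervalIntegral.integral_add_adjacent_intervals (hint 0 ε) (hint ε (ε + t))
      rw [sub_eq_sub_iff_add_eq_add]
      exact (add_comm _ _).trans (e1.trans (e2.symm.trans (add_comm _ _)))
    have h3 : ∀ a : ℝ, 0 ≤ a → a ≤ ε → ‖∫ s in a..(a + t), T (max s 0) v‖ ≤ K * ‖v‖ * t := by
      intro a ha haε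
      have := intervalIntegral.norm_integral_le_of_norm_le_const (a := a) (b := a + t)
        (f := fun s => T (max s 0) v) (C := K * ‖v‖) fun s hs => by
          rw [uIoc_of_le (by linarith [ht.1])] at hs
          refine (T _).le_of_opNorm_le (hK _ ⟨le_max_right _ _, max_le ?_ ?_⟩) _ <;>
            linarith [hs.2, ht.2]
      rwa [add_sub_cancel_left, abs_of_nonneg ht.1] at this
    rw [h1, h2]
    refine (norm_sub_le _ _).trans ?_
    have h4 := h3 0 le_rfl hε.le
    rw [zero_add] at h4
    linarith [h3 ε hε.le le_rfl]
  have hzero : ∀ ε : ℝ, 0 < ε → ∫ s in (0 : ℝ)..ε, l (T (max s 0) v) = 0 := fun ε hε => by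
    rw [l.intervalIntegral_comp_comm (hint _ _)]; exact hl _ (hz ε hε)
  -- Differentiating the vanishing averages in `ε`; right continuity at `0` then yields `l v = 0`.
  have hpos : ∀ ε : ℝ, 0 < ε → l (T (max ε 0) v) = 0 := fun ε hε => by
    have h1 := (hmax l).deriv_integral _ 0 ε
    rw [← h1]
    have : (fun u : ℝ => ∫ s in (0 : ℝ)..u, l (T (max s 0) v)) =ᶠ[𝓝 ε] fun _ => 0 :=
      mem_of_superset (Ioi_mem_nhds hε) fun u hu => hzero u hu
    rw [this.deriv_eq, deriv_const]
  refine hne ?_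
  have h1 : Tendsto (fun t : ℝ => l (T (max t 0) v)) (𝓝[>] 0) (𝓝 (l (T (max 0 0) v))) :=
    (hmax l).continuousWithinAt
  have h2 : Tendsto (fun t : ℝ => l (T (max t 0) v)) (𝓝[>] 0) (𝓝 0) :=
    tendsto_const_nhds.congr' (eventually_nhdsWithin_of_forall fun t ht => (hpos t ht).symm)
  have := tendsto_nhds_unique h1 h2
  simpa [zero] using this

end Weak

/-! ### Volterra convolutions with locally integrable kernels -/

theorem continuousOn_Ici_of_Icc {X : Type*} [TopologicalSpace X] {f : ℝ → X}
    (h : ∀ T : ℝ, 0 ≤ T → ContinuousOn f (Icc 0 T)) : ContinuousOn f (Ici 0) := by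
  intro t ht
  have ht' : (0 : ℝ) ≤ t := ht
  refine (h (t + 1) (by linarith) t ⟨ht, by linarith⟩).mono_of_mem_nhdsWithin ?_
  filter_upwards [self_mem_nhdsWithin, nhdsWithin_le_nhds (Iic_mem_nhds (lt_add_one t))]
    with s hs hs1 using ⟨hs, hs1⟩

theorem ContinuousOn.exists_bound_Icc {V : Type*} [NormedAddCommGroup V] {f : ℝ → V}
    (hf : ContinuousOn f (Ici 0)) (T : ℝ) : ∃ C : ℝ, 0 ≤ C ∧ ∀ s ∈ Icc (0 : ℝ) T, ‖f s‖ ≤ C := by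
  obtain ⟨C, hC⟩ := isCompact_Icc.exists_bound_of_continuousOn
    (hf.mono (Icc_subset_Ici_self : Icc 0 T ⊆ Ici 0))
  exact ⟨max C 0, le_max_right _ _, fun s hs => (hC s hs).trans (le_max_left _ _)⟩

section Bilinear

variable {A B C : Type*} [NormedAddCommGroup A] [NormedSpace ℝ A] [NormedAddCommGroup B]
  [NormedSpace ℝ B] [NormedAddCommGroup C] [NormedSpace ℝ C]

omit [NormedSpace ℝ B] in
theorem intervalIntegrable_reflect {k : ℝ → B} {t : ℝ} (ht : 0 ≤ t)
    (hk : IntegrableOn k (Ioc 0 t)) : IntervalIntegrable (fun s => k (t - s)) volume 0 t := by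
  have h := ((intervalIntegrable_iff_integrableOn_Ioc_of_le ht).2 hk).comp_sub_left t
  simpa using h.symm

theorem intervalIntegrable_volterra (L : A →L[ℝ] B →L[ℝ] C) {f : ℝ → A} {k : ℝ → B} {t : ℝ}
    (ht : 0 ≤ t) (hk : IntegrableOn k (Ioc 0 t)) (hf : ContinuousOn f (Icc 0 t)) :
    IntervalIntegrable (fun s => L (f s) (k (t - s))) volume 0 t := by
  obtain ⟨M, hM⟩ := isCompact_Icc.exists_bound_of_continuousOn hf
  have hk' := intervalIntegrable_reflect ht hk
  rw [intervalIntegrable_iff_integrableOn_Ioc_of_le ht] at hk' ⊢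
  refine Integrable.mono' (hk'.norm.const_mul (‖L‖ * M)) ?_ ?_
  · exact L.aestronglyMeasurable_comp₂
      ((hf.mono Ioc_subset_Icc_self).aestronglyMeasurable measurableSet_Ioc)
      hk'.aestronglyMeasurable
  · refine (ae_restrict_mem measurableSet_Ioc).mono fun s hs => ?_
    refine (L.le_opNorm₂ _ _).trans ?_
    gcongr
    exact hM s (Ioc_subset_Icc_self hs)

/-- After reflecting the variable only the continuous factor depends on `t`, and dominated
convergence applies to integrand and endpoint together. Extending `f` by `f 0` and `k` by zero to
the left of `0` gives room around `t = 0`. -/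
theorem continuousOn_volterra (L : A →L[ℝ] B →L[ℝ] C) {f : ℝ → A} {k : ℝ → B}
    (hk : ∀ T : ℝ, IntegrableOn k (Ioc 0 T)) (hf : ContinuousOn f (Ici 0)) :
    ContinuousOn (fun t => ∫ s in (0 : ℝ)..t, L (f s) (k (t - s))) (Ici 0) := by
  have hf' : Continuous fun t : ℝ => f (max t 0) :=
    hf.comp_continuous (by fun_prop) fun t => mem_Ici.2 (le_max_right _ _)
  have key : ∀ t : ℝ, 0 ≤ t → ContinuousAt
      (fun t => ∫ s in (0 : ℝ)..t, L (f (max (t - s) 0)) ((Ioi (0 : ℝ)).indicator k s)) t := by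
    intro t₀ ht₀
    obtain ⟨M, hM⟩ := (isCompact_Icc (a := -(t₀ + 2)) (b := t₀ + 2)).exists_bound_of_continuousOn
      hf'.continuousOn
    have hki : IntegrableOn ((Ioi (0 : ℝ)).indicator k) (Ioc (-1) (t₀ + 1)) := by
      rw [IntegrableOn, integrable_indicator_iff measurableSet_Ioi, IntegrableOn,
        Measure.restrict_restrict measurableSet_Ioi]
      exact (hk (t₀ + 1)).mono_set fun s hs => ⟨hs.1, hs.2.2⟩
    have hu : uIoc (-1) (t₀ + 1) = Ioc (-1) (t₀ + 1) := uIoc_of_le (by linarith)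
    have h := intervalIntegral.continuousAt_parametric_primitive_of_dominated (μ := volume)
      (F := fun t s => L (f (max (t - s) 0)) ((Ioi (0 : ℝ)).indicator k s))
      (fun s => ‖L‖ * M * ‖(Ioi (0 : ℝ)).indicator k s‖) (-1) (t₀ + 1) (a₀ := 0) (b₀ := t₀)
      (x₀ := t₀) ?_ ?_ ?_ ?_ ⟨by norm_num, by linarith⟩ ⟨by linarith, by linarith⟩ (by simp)
    -- The parameter and the upper endpoint are both `t`: joint continuity is restricted to the
    -- diagonal.
    · exact ContinuousAt.comp (f := fun t : ℝ => (t, t)) h (by fun_prop)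
    · intro x
      rw [hu]
      refine L.aestronglyMeasurable_comp₂ ?_ hki.aestronglyMeasurable
      exact (hf'.comp (continuous_const.sub continuous_id)).aestronglyMeasurable
    · filter_upwards [Icc_mem_nhds (sub_one_lt t₀) (lt_add_one t₀)] with x hx
      rw [hu]
      refine (ae_restrict_mem measurableSet_Ioc).mono fun s hs => ?_
      refine (L.le_opNorm₂ _ _).trans ?_
      gcongr
      exact hM (x - s) ⟨by linarith [hx.1, hs.2], by linarith [hx.2, hs.1]⟩
    · rw [intervalIntegrable_iff_integrableOn_Ioc_of_le (by linarith)]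
      exact hki.norm.const_mul _
    · refine Eventually.of_forall fun s => ?_
      have : Continuous fun x : ℝ => L (f (max (x - s) 0)) ((Ioi (0 : ℝ)).indicator k s) :=
        (L.continuous.comp (hf'.comp (continuous_id.sub continuous_const))).clm_apply
          continuous_const
      exact this.continuousAt
  have hcont : ContinuousOn
      (fun t => ∫ s in (0 : ℝ)..t, L (f (max (t - s) 0)) ((Ioi (0 : ℝ)).indicator k s)) (Ici 0) :=
    fun t ht => (key t ht).continuousWithinAt
  refine hcont.congr fun t ht => ?_
  have ht' : (0 : ℝ) ≤ t := ht
  have h1 := intervalIntegral.integral_comp_sub_left (a := 0) (b := t)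
    (fun s => L (f (t - s)) (k s)) t
  simp only [sub_sub_cancel, sub_self, sub_zero] at h1
  simp only
  rw [h1]
  refine intervalIntegral.integral_congr_ae (Eventually.of_forall fun s hs => ?_)
  rw [uIoc_of_le ht'] at hs
  rw [indicator_of_mem (mem_Ioi.2 hs.1), max_eq_left (by linarith [hs.2])]

end Bilinear

section Scalar

variable {V : Type*} [NormedAddCommGroup V] [NormedSpace ℝ V]

theorem intervalIntegrable_smul_kernel {f : ℝ → ℝ} {D : ℝ → V} {t : ℝ} (ht : 0 ≤ t)
    (hD : IntegrableOn D (Ioc 0 t)) (hf : ContinuousOn f (Icc 0 t)) :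
    IntervalIntegrable (fun s => f s • D (t - s)) volume 0 t :=
  intervalIntegrable_volterra (ContinuousLinearMap.lsmul ℝ ℝ) ht hD hf

theorem intervalIntegrable_kernel_smul {f : ℝ → V} {k : ℝ → ℝ} {t : ℝ} (ht : 0 ≤ t)
    (hk : IntegrableOn k (Ioc 0 t)) (hf : ContinuousOn f (Icc 0 t)) :
    IntervalIntegrable (fun s => k (t - s) • f s) volume 0 t :=
  intervalIntegrable_volterra (ContinuousLinearMap.lsmul ℝ ℝ).flip ht hk hf

theorem continuousOn_smul_kernel {f : ℝ → ℝ} {D : ℝ → V}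
    (hD : ∀ T : ℝ, IntegrableOn D (Ioc 0 T)) (hf : ContinuousOn f (Ici 0)) :
    ContinuousOn (fun t => ∫ s in (0 : ℝ)..t, f s • D (t - s)) (Ici 0) :=
  continuousOn_volterra (ContinuousLinearMap.lsmul ℝ ℝ) hD hf

theorem continuousOn_kernel_smul {f : ℝ → V} {k : ℝ → ℝ}
    (hk : ∀ T : ℝ, IntegrableOn k (Ioc 0 T)) (hf : ContinuousOn f (Ici 0)) :
    ContinuousOn (fun t => ∫ s in (0 : ℝ)..t, k (t - s) • f s) (Ici 0) :=
  continuousOn_volterra (ContinuousLinearMap.lsmul ℝ ℝ).flip hk hf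

/-! ### Linear Volterra equations -/

/-- Dominated convergence as the exponent grows. The constant `1 / 2` makes convolution with `k` a
contraction in an exponentially weighted sup norm on all of `[0, T]`, even for unbounded `k`. -/
theorem exists_exp_weight {k : ℝ → ℝ} {T : ℝ} (hk : IntegrableOn k (Ioc 0 T)) :
    ∃ β : ℝ, 0 ≤ β ∧ ∫ s in Ioc 0 T, Real.exp (-(β * s)) * ‖k s‖ ≤ 1 / 2 := by
  have h : Tendsto (fun n : ℕ => ∫ s in Ioc 0 T, Real.exp (-((n : ℝ) * s)) * ‖k s‖) atTop
      (𝓝 (∫ _ in Ioc 0 T, (0 : ℝ))) := by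
    refine tendsto_integral_of_dominated_convergence (fun s => ‖k s‖) (fun n => ?_) hk.norm
      (fun n => ?_) ?_
    · exact (Continuous.aestronglyMeasurable (by fun_prop)).mul hk.norm.aestronglyMeasurable
    · refine (ae_restrict_mem measurableSet_Ioc).mono fun s hs => ?_
      rw [norm_mul, norm_norm, Real.norm_of_nonneg (Real.exp_pos _).le]
      refine mul_le_of_le_one_left (norm_nonneg _) (Real.exp_le_one_iff.2 ?_)
      have := hs.1.le
      have : 0 ≤ (n : ℝ) * s := by positivity
      linarith
    · refine (ae_restrict_mem measurableSet_Ioc).mono fun s hs => ?_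
      have h1 : Tendsto (fun n : ℕ => Real.exp (-((n : ℝ) * s))) atTop (𝓝 0) :=
        Real.tendsto_exp_neg_atTop_nhds_zero.comp
          (tendsto_natCast_atTop_atTop.atTop_mul_const hs.1)
      simpa using h1.mul_const ‖k s‖
  rw [integral_zero] at h
  obtain ⟨n, hn⟩ := (h.eventually_le_const (show (0 : ℝ) < 1 / 2 by norm_num)).exists
  exact ⟨n, n.cast_nonneg, hn⟩

theorem norm_volterra_le {k : ℝ → ℝ} {T β : ℝ} (hk : IntegrableOn k (Ioc 0 T))
    (hβ : ∫ s in Ioc 0 T, Real.exp (-(β * s)) * ‖k s‖ ≤ 1 / 2)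
    {f : ℝ → V} {M t : ℝ} (hM : 0 ≤ M) (ht : t ∈ Icc 0 T)
    (hf : ∀ s ∈ Icc 0 t, ‖f s‖ ≤ M * Real.exp (β * s)) :
    ‖∫ s in (0 : ℝ)..t, k (t - s) • f s‖ ≤ M * Real.exp (β * t) / 2 := by
  have hkt : IntegrableOn k (Ioc 0 t) := hk.mono_set (Ioc_subset_Ioc_right ht.2)
  have hint : IntegrableOn (fun s => Real.exp (-(β * s)) * ‖k s‖) (Ioc 0 T) := by
    exact IntegrableOn.continuousOn_mul_of_subset (K := Icc 0 T)
      (g := fun s => Real.exp (-(β * s))) (by fun_prop) hk.norm isCompact_Icc measurableSet_Ioc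
      Ioc_subset_Icc_self
  have hrefl := intervalIntegrable_reflect ht.1 hkt
  calc ‖∫ s in (0 : ℝ)..t, k (t - s) • f s‖
      ≤ ∫ s in (0 : ℝ)..t, ‖k (t - s)‖ * (M * Real.exp (β * s)) := by
        refine intervalIntegral.norm_integral_le_of_norm_le ht.1 (Eventually.of_forall ?_) ?_
        · intro s hs
          rw [norm_smul]
          gcongr
          exact hf s (Ioc_subset_Icc_self hs)
        · exact hrefl.norm.mul_continuousOn (by fun_prop)
    _ = ∫ s in (0 : ℝ)..t, ‖k s‖ * (M * Real.exp (β * (t - s))) := by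
        have h1 := intervalIntegral.integral_comp_sub_left (a := 0) (b := t)
          (fun s => ‖k s‖ * (M * Real.exp (β * (t - s)))) t
        simpa only [sub_sub_cancel, sub_self, sub_zero] using h1
    _ = M * Real.exp (β * t) * ∫ s in (0 : ℝ)..t, Real.exp (-(β * s)) * ‖k s‖ := by
        rw [← intervalIntegral.integral_const_mul]
        congr 1; funext s
        rw [mul_sub, sub_eq_add_neg, Real.exp_add]; ring
    _ ≤ M * Real.exp (β * t) * (1 / 2) := by
        gcongr
        rw [intervalIntegral.integral_of_le ht.1]
        refine le_trans (setIntegral_mono_set hint ?_ ?_) hβ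
        · exact Eventually.of_forall fun s => by positivity
        · exact (Ioc_subset_Ioc_right ht.2).eventuallyLE
    _ = M * Real.exp (β * t) / 2 := by ring

/-- Stability of linear Volterra equations: the solution is controlled by the forcing term. -/
theorem volterra_stability {k : ℝ → ℝ} {T : ℝ} (hk : IntegrableOn k (Ioc 0 T)) :
    ∃ K : ℝ, 0 ≤ K ∧ ∀ (e p : ℝ → V) (P : ℝ), ContinuousOn e (Icc 0 T) →
      (∀ t ∈ Icc 0 T, ‖p t‖ ≤ P) →
      (∀ t ∈ Icc 0 T, e t = p t + ∫ s in (0 : ℝ)..t, k (t - s) • e s) →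
      ∀ t ∈ Icc 0 T, ‖e t‖ ≤ K * P := by
  obtain ⟨β, hβ0, hβ⟩ := exists_exp_weight hk
  refine ⟨2 * Real.exp (β * T), by positivity, fun e p P he hp heq t ht => ?_⟩
  have hP : 0 ≤ P := (norm_nonneg _).trans (hp t ht)
  -- At a maximum `M` of the weighted norm the equation gives `M ≤ P + M / 2`, so `M ≤ 2 * P`.
  obtain ⟨τ, hτ, hmax⟩ := isCompact_Icc.exists_isMaxOn (f := fun s => Real.exp (-(β * s)) * ‖e s‖)
    ⟨t, ht⟩ (ContinuousOn.mul (by fun_prop) he.norm)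
  set M := Real.exp (-(β * τ)) * ‖e τ‖ with hMdef
  have hexp : ∀ s : ℝ, Real.exp (-(β * s)) * Real.exp (β * s) = 1 := fun s => by
    rw [← Real.exp_add]; simp
  have hle : ∀ s ∈ Icc 0 T, ‖e s‖ ≤ M * Real.exp (β * s) := by
    intro s hs
    have h1 : Real.exp (-(β * s)) * ‖e s‖ ≤ M := hmax hs
    calc ‖e s‖ = (Real.exp (-(β * s)) * Real.exp (β * s)) * ‖e s‖ := by rw [hexp, one_mul]
      _ = (Real.exp (-(β * s)) * ‖e s‖) * Real.exp (β * s) := by ring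
      _ ≤ _ := by gcongr
  have hM0 : 0 ≤ M := by positivity
  have h2 : ‖e τ‖ ≤ P + M * Real.exp (β * τ) / 2 := by
    rw [heq τ hτ]
    refine (norm_add_le _ _).trans (add_le_add (hp τ hτ) ?_)
    exact norm_volterra_le hk hβ hM0 hτ fun s hs => hle s ⟨hs.1, hs.2.trans hτ.2⟩
  have h3 : M ≤ P + M / 2 := by
    calc M ≤ Real.exp (-(β * τ)) * (P + M * Real.exp (β * τ) / 2) := by rw [hMdef]; gcongr
      _ = Real.exp (-(β * τ)) * P + M / 2 * (Real.exp (-(β * τ)) * Real.exp (β * τ)) := by ring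
      _ ≤ 1 * P + M / 2 * 1 := by
          rw [hexp]
          gcongr
          rw [Real.exp_le_one_iff]
          have := mul_nonneg hβ0 hτ.1
          linarith
      _ = P + M / 2 := by ring
  calc ‖e t‖ ≤ M * Real.exp (β * t) := hle t ht
    _ ≤ (2 * P) * Real.exp (β * T) := by
        gcongr
        · linarith
        · exact ht.2
    _ = _ := by ring

theorem volterra_unique {k : ℝ → ℝ} (hk : ∀ T : ℝ, IntegrableOn k (Ioc 0 T)) {F e₁ e₂ : ℝ → V}
    (h₁ : ContinuousOn e₁ (Ici 0)) (h₂ : ContinuousOn e₂ (Ici 0))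
    (eq₁ : ∀ t : ℝ, 0 ≤ t → e₁ t = F t + ∫ s in (0 : ℝ)..t, k (t - s) • e₁ s)
    (eq₂ : ∀ t : ℝ, 0 ≤ t → e₂ t = F t + ∫ s in (0 : ℝ)..t, k (t - s) • e₂ s) :
    EqOn e₁ e₂ (Ici 0) := by
  intro t ht
  obtain ⟨K, -, hK⟩ := volterra_stability (V := V) (hk t)
  have hsub : Icc 0 t ⊆ Ici (0 : ℝ) := Icc_subset_Ici_self
  have := hK (fun s => e₁ s - e₂ s) (fun _ => 0) 0 ((h₁.sub h₂).mono hsub) (by simp)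
    (fun s hs => by
      have hsub' : Icc 0 s ⊆ Ici (0 : ℝ) := Icc_subset_Ici_self
      simp only [smul_sub]
      rw [intervalIntegral.integral_sub
        (intervalIntegrable_kernel_smul hs.1 (hk s) (h₁.mono hsub'))
        (intervalIntegrable_kernel_smul hs.1 (hk s) (h₂.mono hsub')), eq₁ s hs.1, eq₂ s hs.1]
      abel) t ⟨ht, le_rfl⟩
  rw [mul_zero, norm_le_zero_iff, sub_eq_zero] at this
  exact this

/-- Iterated Volterra convolutions of `F` with the kernel `k`. -/
noncomputable def volterraIterate (k : ℝ → ℝ) (F : ℝ → V) : ℕ → ℝ → V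
  | 0 => F
  | n + 1 => fun t => ∫ s in (0 : ℝ)..t, k (t - s) • volterraIterate k F n s

/-- Neumann series: the iterates decay like `(1 / 2) ^ n` uniformly on compact intervals, so their
sum is continuous and may be integrated term by term. -/
theorem volterra_exists [CompleteSpace V] {k : ℝ → ℝ} (hk : ∀ T : ℝ, IntegrableOn k (Ioc 0 T))
    {F : ℝ → V} (hF : ContinuousOn F (Ici 0)) :
    ∃ G : ℝ → V, ContinuousOn G (Ici 0) ∧
      ∀ t : ℝ, 0 ≤ t → G t = F t + ∫ s in (0 : ℝ)..t, k (t - s) • G s := by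
  set u := volterraIterate k F with hu
  have hcont : ∀ n, ContinuousOn (u n) (Ici 0) := by
    intro n
    induction n with
    | zero => exact hF
    | succ n ih => exact continuousOn_kernel_smul hk ih
  have hbound : ∀ T : ℝ, ∃ K : ℝ, 0 ≤ K ∧ ∀ n : ℕ, ∀ t ∈ Icc 0 T, ‖u n t‖ ≤ K * (1 / 2) ^ n := by
    intro T
    obtain ⟨β, hβ0, hβ⟩ := exists_exp_weight (hk T)
    obtain ⟨M, hM0, hM⟩ := hF.exists_bound_Icc T
    have h : ∀ n : ℕ, ∀ t ∈ Icc 0 T, ‖u n t‖ ≤ M * (1 / 2) ^ n * Real.exp (β * t) := by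
      intro n
      induction n with
      | zero =>
        intro t ht
        have h1 : 1 ≤ Real.exp (β * t) := Real.one_le_exp (mul_nonneg hβ0 ht.1)
        calc ‖u 0 t‖ ≤ M := hM t ht
          _ ≤ M * Real.exp (β * t) := le_mul_of_one_le_right hM0 h1
          _ = _ := by ring
      | succ n ih =>
        intro t ht
        have := norm_volterra_le (hk T) hβ (f := u n) (M := M * (1 / 2) ^ n) (by positivity) ht
          fun s hs => ih s ⟨hs.1, hs.2.trans ht.2⟩
        refine this.trans (le_of_eq ?_)
        rw [pow_succ]; ring
    refine ⟨M * Real.exp (β * T), by positivity, fun n t ht => (h n t ht).trans ?_⟩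
    calc M * (1 / 2) ^ n * Real.exp (β * t) ≤ M * (1 / 2) ^ n * Real.exp (β * T) := by
          gcongr; exact ht.2
      _ = _ := by ring
  have hgeom : ∀ K : ℝ, Summable fun n : ℕ => K * (1 / 2 : ℝ) ^ n := fun K =>
    (summable_geometric_of_lt_one (by norm_num) (by norm_num)).mul_left K
  have hsum : ∀ t : ℝ, 0 ≤ t → HasSum (fun n => u n t) (∑' n, u n t) := by
    intro t ht
    obtain ⟨K, -, hK⟩ := hbound t
    exact (Summable.of_norm_bounded (hgeom K) fun n => hK n t ⟨ht, le_rfl⟩).hasSum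
  refine ⟨fun t => ∑' n, u n t, continuousOn_Ici_of_Icc fun T hT => ?_, fun t ht => ?_⟩
  · obtain ⟨K, -, hK⟩ := hbound T
    exact continuousOn_tsum (fun n => (hcont n).mono Icc_subset_Ici_self) (hgeom K) hK
  · obtain ⟨K, hK0, hK⟩ := hbound t
    have h1 : HasSum (fun n => u (n + 1) t) (∫ s in (0 : ℝ)..t, k (t - s) • ∑' n, u n s) := by
      refine intervalIntegral.hasSum_integral_of_dominated_convergence
        (fun n s => ‖k (t - s)‖ * (K * (1 / 2) ^ n)) (fun n => ?_) (fun n => ?_) ?_ ?_ ?_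
      · have := intervalIntegrable_kernel_smul ht (hk t)
          ((hcont n).mono (Icc_subset_Ici_self : Icc 0 t ⊆ Ici 0))
        exact this.def'.aestronglyMeasurable
      · refine Eventually.of_forall fun s hs => ?_
        rw [uIoc_of_le ht] at hs
        rw [norm_smul]
        gcongr
        exact hK n s (Ioc_subset_Icc_self hs)
      · exact Eventually.of_forall fun s _ => (hgeom K).mul_left _
      · simp only [tsum_mul_left]
        exact (intervalIntegrable_reflect ht (hk t)).norm.mul_const _
      · refine Eventually.of_forall fun s hs => ?_
        rw [uIoc_of_le ht] at hs
        exact (hsum s hs.1.le).const_smul _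
    have h2 : HasSum (fun n => u n t) (u 0 t + ∫ s in (0 : ℝ)..t, k (t - s) • ∑' n, u n s) :=
      HasSum.zero_add (f := fun n => u n t) h1
    have h0 : u 0 t = F t := rfl
    rw [h0] at h2
    exact h2.tsum_eq

end Scalar

/-! ### Associativity of Volterra convolutions -/

section Assoc
variable {V : Type*} [NormedAddCommGroup V] [NormedSpace ℝ V]

/-- Fubini on the triangle `s ≤ τ`, after the substitution `τ = s + σ`. -/
theorem volterra_assoc_of_continuous [CompleteSpace V] {f R : ℝ → ℝ} {D : ℝ → V} {t : ℝ}
    (ht : 0 ≤ t) (hD : IntegrableOn D (Ioc 0 t)) (hf : Continuous f) (hR : Continuous R) :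
    ∫ s in (0 : ℝ)..t, f s • (∫ σ in (0 : ℝ)..(t - s), R σ • D (t - s - σ)) =
      ∫ τ in (0 : ℝ)..t, (∫ s in (0 : ℝ)..τ, f s * R (τ - s)) • D (t - τ) := by
  set μ : Measure ℝ := volume.restrict (Ioc 0 t) with hμ
  set c : ℝ × ℝ → ℝ := {p : ℝ × ℝ | p.1 ≤ p.2}.indicator fun p => f p.1 * R (p.2 - p.1) with hc
  have hset : MeasurableSet {p : ℝ × ℝ | p.1 ≤ p.2} := measurableSet_le measurable_fst measurable_snd
  have hcm : Measurable c := Measurable.indicator (by fun_prop) hset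
  obtain ⟨M, hM⟩ := (isCompact_Icc (a := -t) (b := t)).exists_bound_of_continuousOn hf.continuousOn
  obtain ⟨N, hN⟩ := (isCompact_Icc (a := -t) (b := t)).exists_bound_of_continuousOn hR.continuousOn
  have hDr : Integrable (fun τ => D (t - τ)) μ :=
    (intervalIntegrable_iff_integrableOn_Ioc_of_le ht).1 (intervalIntegrable_reflect ht hD)
  have hDp : Integrable (fun p : ℝ × ℝ => D (t - p.2)) (μ.prod μ) := hDr.comp_snd μ
  have hmem : ∀ᵐ p : ℝ × ℝ ∂(μ.prod μ), p ∈ Ioc 0 t ×ˢ Ioc 0 t := by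
    rw [hμ, Measure.prod_restrict]
    exact ae_restrict_mem (measurableSet_Ioc.prod measurableSet_Ioc)
  have hint : Integrable (fun p : ℝ × ℝ => c p • D (t - p.2)) (μ.prod μ) := by
    refine Integrable.mono' (hDp.norm.const_mul (M * N))
      (hcm.aestronglyMeasurable.smul hDp.aestronglyMeasurable) ?_
    refine hmem.mono fun p hp => ?_
    rw [norm_smul]
    gcongr
    have h1 := hM p.1 ⟨by linarith [hp.1.1], hp.1.2⟩
    have h2 := hN (p.2 - p.1) ⟨by linarith [hp.1.2, hp.2.1], by linarith [hp.1.1, hp.2.2]⟩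
    have hM0 := (norm_nonneg _).trans h1
    have hN0 := (norm_nonneg _).trans h2
    refine (norm_indicator_le_norm_self _ _).trans ?_
    rw [norm_mul]
    gcongr
  have hswap := integral_integral_swap (μ := μ) (ν := μ) (f := fun s τ => c (s, τ) • D (t - τ)) hint
  have hleft : ∫ s in (0 : ℝ)..t, f s • (∫ σ in (0 : ℝ)..(t - s), R σ • D (t - s - σ)) =
      ∫ s, ∫ τ, c (s, τ) • D (t - τ) ∂μ ∂μ := by
    rw [intervalIntegral.integral_of_le ht]
    refine setIntegral_congr_fun measurableSet_Ioc fun s hs => ?_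
    have h1 := intervalIntegral.integral_comp_sub_right (a := s) (b := t)
      (fun σ => R σ • D (t - s - σ)) s
    rw [sub_self] at h1
    have h2 : ∀ τ, c (s, τ) • D (t - τ) =
        (Ici s).indicator (fun τ => (f s * R (τ - s)) • D (t - τ)) τ := by
      intro τ
      by_cases h : s ≤ τ
      · rw [indicator_of_mem (mem_Ici.2 h), hc, indicator_of_mem (by exact h)]
      · rw [indicator_of_notMem (by simpa using h), hc, indicator_of_notMem (by exact h), zero_smul]
    have h3 : Ioc 0 t ∩ Ici s = Icc s t := by
      ext τ
      simp only [mem_inter_iff, mem_Ioc, mem_Ici, mem_Icc]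
      exact ⟨fun h => ⟨h.2, h.1.2⟩, fun h => ⟨⟨hs.1.trans_le h.1, h.2⟩, h.1⟩⟩
    simp only [h2]
    rw [setIntegral_indicator measurableSet_Ici, h3, integral_Icc_eq_integral_Ioc,
      ← intervalIntegral.integral_of_le hs.2, ← h1, ← intervalIntegral.integral_smul]
    refine intervalIntegral.integral_congr fun τ _ => ?_
    simp only [sub_sub_sub_cancel_right, smul_smul]
  have hright : ∫ τ in (0 : ℝ)..t, (∫ s in (0 : ℝ)..τ, f s * R (τ - s)) • D (t - τ) =
      ∫ τ, ∫ s, c (s, τ) • D (t - τ) ∂μ ∂μ := by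
    rw [intervalIntegral.integral_of_le ht]
    refine setIntegral_congr_fun measurableSet_Ioc fun τ hτ => ?_
    have h2 : ∀ s, c (s, τ) = (Iic τ).indicator (fun s => f s * R (τ - s)) s := by
      intro s
      by_cases h : s ≤ τ
      · rw [indicator_of_mem (mem_Iic.2 h), hc, indicator_of_mem (by exact h)]
      · rw [indicator_of_notMem (by simpa using h), hc, indicator_of_notMem (by exact h)]
    have h3 : Ioc 0 t ∩ Iic τ = Ioc 0 τ := by
      ext s
      simp only [mem_inter_iff, mem_Ioc, mem_Iic]
      exact ⟨fun h => ⟨h.1.1, h.2⟩, fun h => ⟨⟨h.1, h.2.trans hτ.2⟩, h.2⟩⟩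
    rw [integral_smul_const]
    simp only [h2]
    rw [setIntegral_indicator measurableSet_Iic, h3, ← intervalIntegral.integral_of_le hτ.1.le]
  rw [hleft, hright, hswap]

/-- Associativity of Volterra convolutions. -/
theorem volterra_assoc [CompleteSpace V] {f R : ℝ → ℝ} {D : ℝ → V} {t : ℝ}
    (ht : 0 ≤ t) (hD : IntegrableOn D (Ioc 0 t)) (hf : ContinuousOn f (Ici 0))
    (hR : ContinuousOn R (Ici 0)) :
    ∫ s in (0 : ℝ)..t, f s • (∫ σ in (0 : ℝ)..(t - s), R σ • D (t - s - σ)) =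
      ∫ τ in (0 : ℝ)..t, (∫ s in (0 : ℝ)..τ, f s * R (τ - s)) • D (t - τ) := by
  have hext : ∀ {g : ℝ → ℝ}, ContinuousOn g (Ici 0) → Continuous fun s : ℝ => g (max s 0) :=
    fun hg => hg.comp_continuous (by fun_prop) fun s => mem_Ici.2 (le_max_right _ _)
  have h := volterra_assoc_of_continuous ht hD (hext hf) (hext hR)
  refine Eq.trans ?_ (h.trans ?_)
  · refine intervalIntegral.integral_congr fun s hs => ?_
    rw [uIcc_of_le ht] at hs
    simp only [max_eq_left hs.1]
    congr 1
    refine intervalIntegral.integral_congr fun σ hσ => ?_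
    rw [uIcc_of_le (by linarith [hs.2])] at hσ
    simp only [max_eq_left hσ.1]
  · refine intervalIntegral.integral_congr fun τ hτ => ?_
    rw [uIcc_of_le ht] at hτ
    congr 1
    refine intervalIntegral.integral_congr fun s hs => ?_
    rw [uIcc_of_le hτ.1] at hs
    simp only [max_eq_left hs.1, max_eq_left (sub_nonneg.2 hs.2)]

end Assoc

/-! ### Linear flows with a rank-one perturbation -/

section Flow

variable {Y : Type*} [NormedAddCommGroup Y] [NormedSpace ℝ Y]

/-- A strongly continuous semigroup `SY` on `Y*`, adjoint to a strongly continuous semigroup `T` on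
`Y`, together with a locally integrable orbit `D` of `SY` on `(0, ∞)`. -/
structure IsAdjointOrbit (SY : ℝ → StrongDual ℝ Y →L[ℝ] StrongDual ℝ Y) (T : ℝ → Y →L[ℝ] Y)
    (D : ℝ → StrongDual ℝ Y) : Prop where
  semigroupY : IsStronglyContinuousSemigroup SY
  semigroup : IsStronglyContinuousSemigroup T
  adjoint : ∀ t : ℝ, 0 ≤ t → ∀ (l : StrongDual ℝ Y) (y : Y), SY t l y = l (T t y)
  orbit : ∀ u s : ℝ, 0 ≤ u → 0 < s → D (u + s) = SY u (D s)
  integrable : ∀ t : ℝ, IntegrableOn D (Ioc 0 t)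

/-- `G` solves the dual Volterra equation `G_t = T_t g - w ∫_0^t ⟨g, D_{t-s}⟩ G_s ds` in `Y`. -/
structure IsDualSolution (T : ℝ → Y →L[ℝ] Y) (D : ℝ → StrongDual ℝ Y) (g : Y) (w : ℝ)
    (G : ℝ → Y) : Prop where
  continuousOn : ContinuousOn G (Ici 0)
  eq : ∀ t : ℝ, 0 ≤ t → G t = T t g + ∫ s in (0 : ℝ)..t, (-w * D (t - s) g) • G s

/-- The mild solution started at `l₀`, expressed through a solution `G` of the dual equation. -/
noncomputable def mildFlow (SY : ℝ → StrongDual ℝ Y →L[ℝ] StrongDual ℝ Y) (D : ℝ → StrongDual ℝ Y) (w : ℝ)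
    (G : ℝ → Y) (l₀ : StrongDual ℝ Y) (t : ℝ) : StrongDual ℝ Y :=
  SY t l₀ - w • ∫ s in (0 : ℝ)..t, l₀ (G s) • D (t - s)

variable {SY : ℝ → StrongDual ℝ Y →L[ℝ] StrongDual ℝ Y} {T : ℝ → Y →L[ℝ] Y}
  {D : ℝ → StrongDual ℝ Y} {g : Y} {w w' : ℝ} {G G' : ℝ → Y}

namespace IsAdjointOrbit

theorem integrable_eval (hD : IsAdjointOrbit SY T D) (y : Y) (t : ℝ) :
    IntegrableOn (fun s => D s y) (Ioc 0 t) :=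
  (NormedSpace.inclusionInDoubleDual ℝ Y y).integrable_comp (hD.integrable t)

theorem integrable_kernel (hD : IsAdjointOrbit SY T D) (w : ℝ) (g : Y) (t : ℝ) :
    IntegrableOn (fun s => -w * D s g) (Ioc 0 t) :=
  (hD.integrable_eval g t).const_mul (-w)

theorem exists_dualSolution [CompleteSpace Y] (hD : IsAdjointOrbit SY T D) (g : Y) (w : ℝ) :
    ∃ G, IsDualSolution T D g w G := by
  obtain ⟨G, h1, h2⟩ := volterra_exists (hD.integrable_kernel w g)
    (hD.semigroup.continuousOn_orbit g)
  exact ⟨G, h1, h2⟩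

theorem eval_integral (hD : IsAdjointOrbit SY T D) {f : ℝ → ℝ} {t : ℝ} (ht : 0 ≤ t)
    (hf : ContinuousOn f (Ici 0)) (y : Y) :
    (∫ s in (0 : ℝ)..t, f s • D (t - s)) y = ∫ s in (0 : ℝ)..t, f s * D (t - s) y := by
  have h := (NormedSpace.inclusionInDoubleDual ℝ Y y).intervalIntegral_comp_comm
    (intervalIntegrable_smul_kernel ht (hD.integrable t) (hf.mono Icc_subset_Ici_self))
  simp only [NormedSpace.dual_def, smul_apply, smul_eq_mul] at h
  exact h.symm

/-- On positive times `SY u (D s)` is `D (u + s)`, so this is continuity of translation in `L¹`. It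
justifies replacing the missing initial value `ν` by `D u`. -/
theorem tendsto_integral_norm_sub (hD : IsAdjointOrbit SY T D) (t : ℝ) :
    Tendsto (fun u => ∫ s in Ioc 0 t, ‖SY u (D s) - D s‖) (𝓝[>] 0) (𝓝 0) := by
  obtain ⟨M, hM0, hM⟩ := hD.semigroupY.exists_bound 1
  have h := tendsto_integral_filter_of_dominated_convergence (μ := volume.restrict (Ioc 0 t))
    (l := 𝓝[>] (0 : ℝ)) (F := fun u s => ‖SY u (D s) - D s‖) (f := fun _ => (0 : ℝ))
    (fun s => (M + 1) * ‖D s‖) ?_ ?_ ((hD.integrable t).norm.const_mul _) ?_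
  · simpa using h
  · exact Eventually.of_forall fun u =>
      (((SY u).integrable_comp (hD.integrable t)).sub (hD.integrable t)).norm.aestronglyMeasurable
  · filter_upwards [Ioc_mem_nhdsGT one_pos] with u hu
    refine Eventually.of_forall fun s => ?_
    rw [norm_norm, add_mul, one_mul]
    exact (norm_sub_le _ _).trans (by
      gcongr; exact (SY u).le_of_opNorm_le (hM u (Ioc_subset_Icc_self hu)) _)
  · refine Eventually.of_forall fun s => ?_
    simpa using ((hD.semigroupY.strong (D s)).sub_const (D s)).norm

end IsAdjointOrbit

theorem norm_integral_smul_kernel_le {E : ℝ → Y} {f : ℝ → ℝ}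
    {H t a : ℝ} (ht : 0 ≤ t) (hta : t ≤ a) (hE : IntegrableOn E (Ioc 0 a)) (hH : 0 ≤ H)
    (hf : ∀ s ∈ Icc 0 t, ‖f s‖ ≤ H) :
    ‖∫ s in (0 : ℝ)..t, f s • E (t - s)‖ ≤ H * ∫ s in Ioc 0 a, ‖E s‖ := by
  have hEt : IntegrableOn E (Ioc 0 t) := hE.mono_set (Ioc_subset_Ioc_right hta)
  calc ‖∫ s in (0 : ℝ)..t, f s • E (t - s)‖ ≤ ∫ s in (0 : ℝ)..t, H * ‖E (t - s)‖ := by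
        refine intervalIntegral.norm_integral_le_of_norm_le ht (Eventually.of_forall ?_) ?_
        · intro s hs
          rw [norm_smul]
          gcongr
          exact hf s (Ioc_subset_Icc_self hs)
        · exact (intervalIntegrable_reflect ht hEt).norm.const_mul _
    _ = H * ∫ s in Ioc 0 t, ‖E s‖ := by
        rw [intervalIntegral.integral_const_mul,
          intervalIntegral.integral_comp_sub_left (fun s => ‖E s‖) t, sub_self, sub_zero,
          intervalIntegral.integral_of_le ht]
    _ ≤ _ := by
        refine mul_le_mul_of_nonneg_left ?_ hH
        exact setIntegral_mono_set hE.norm (Eventually.of_forall fun s => norm_nonneg _)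
          (Ioc_subset_Ioc_right hta).eventuallyLE

theorem IsDualSolution.continuousOn_apply (hG : IsDualSolution T D g w G) (l : StrongDual ℝ Y) :
    ContinuousOn (fun s => l (G s)) (Ici 0) :=
  l.continuous.comp_continuousOn hG.continuousOn

/-- The vector that `l` is applied to does not depend on `l`; hence the flow is weak-* continuous in
its initial value. -/
theorem mildFlow_apply [CompleteSpace Y] (hD : IsAdjointOrbit SY T D)
    (hG : IsDualSolution T D g w G) (l : StrongDual ℝ Y) {t : ℝ} (ht : 0 ≤ t) (y : Y) :
    mildFlow SY D w G l t y = l (T t y - w • ∫ s in (0 : ℝ)..t, D (t - s) y • G s) := by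
  have h1 : IntervalIntegrable (fun s => D (t - s) y • G s) volume 0 t :=
    intervalIntegrable_kernel_smul ht (hD.integrable_eval y t)
      (hG.continuousOn.mono Icc_subset_Ici_self)
  rw [mildFlow, sub_apply, smul_apply,
    hD.eval_integral ht (hG.continuousOn_apply l), hD.adjoint t ht, map_sub, map_smul,
    ← l.intervalIntegral_comp_comm h1]
  simp only [map_smul, smul_eq_mul, mul_comm]

/-- At `y = g` the vector in `mildFlow_apply` is the right side of the dual equation. -/
theorem mildFlow_apply_self [CompleteSpace Y] (hD : IsAdjointOrbit SY T D)
    (hG : IsDualSolution T D g w G) (l : StrongDual ℝ Y) {t : ℝ} (ht : 0 ≤ t) :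
    mildFlow SY D w G l t g = l (G t) := by
  rw [mildFlow_apply hD hG l ht, hG.eq t ht, ← intervalIntegral.integral_smul, sub_eq_add_neg,
    ← intervalIntegral.integral_neg]
  simp only [smul_smul, neg_mul, neg_smul]

theorem continuousOn_mildFlow (hD : IsAdjointOrbit SY T D) (hG : IsDualSolution T D g w G)
    (l : StrongDual ℝ Y) : ContinuousOn (mildFlow SY D w G l) (Ici 0) :=
  (hD.semigroupY.continuousOn_orbit l).sub
    ((continuousOn_smul_kernel hD.integrable (hG.continuousOn_apply l)).const_smul w)

theorem mildFlow_zero (hD : IsAdjointOrbit SY T D) (l : StrongDual ℝ Y) :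
    mildFlow SY D w G l 0 = l := by
  simp [mildFlow, hD.semigroupY.zero_apply]

theorem mildFlow_eq [CompleteSpace Y] (hD : IsAdjointOrbit SY T D)
    (hG : IsDualSolution T D g w G) (l : StrongDual ℝ Y) {t : ℝ} (ht : 0 ≤ t) :
    mildFlow SY D w G l t =
      SY t l - w • ∫ s in (0 : ℝ)..t, mildFlow SY D w G l s g • D (t - s) := by
  conv_lhs => rw [mildFlow]
  congr 2
  refine intervalIntegral.integral_congr fun s hs => ?_
  rw [uIcc_of_le ht] at hs
  simp only [mildFlow_apply_self hD hG l hs.1]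

/-- Uniqueness of mild solutions. -/
theorem eqOn_mildFlow [CompleteSpace Y] (hD : IsAdjointOrbit SY T D)
    (hG : IsDualSolution T D g w G) {l₀ : StrongDual ℝ Y} {l : ℝ → StrongDual ℝ Y}
    (hl : ContinuousOn l (Ici 0))
    (heq : ∀ t : ℝ, 0 ≤ t → l t = SY t l₀ - w • ∫ s in (0 : ℝ)..t, l s g • D (t - s)) :
    EqOn l (mildFlow SY D w G l₀) (Ici 0) := by
  have hlg : ∀ {m : ℝ → StrongDual ℝ Y}, ContinuousOn m (Ici 0) →
      ContinuousOn (fun s => m s g) (Ici 0) := fun hm => hm.clm_apply continuousOn_const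
  -- Pairing with `g` closes the equation: `m s g` solves a scalar Volterra equation, and it alone
  -- determines `m` through the mild equation.
  have hscalar : ∀ {m : ℝ → StrongDual ℝ Y}, ContinuousOn m (Ici 0) →
      (∀ t : ℝ, 0 ≤ t → m t = SY t l₀ - w • ∫ s in (0 : ℝ)..t, m s g • D (t - s)) →
      ∀ t : ℝ, 0 ≤ t → m t g = SY t l₀ g + ∫ s in (0 : ℝ)..t, (-w * D (t - s) g) • m s g := by
    intro m hm hmeq t ht
    rw [hmeq t ht, sub_apply, smul_apply,
      hD.eval_integral ht (hlg hm), sub_eq_add_neg, smul_eq_mul, ← neg_mul,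
      ← intervalIntegral.integral_const_mul]
    congr 2
    funext s
    rw [smul_eq_mul]; ring
  have hu := volterra_unique (hD.integrable_kernel w g) (hlg hl)
    (hlg (continuousOn_mildFlow hD hG l₀)) (hscalar hl heq)
    (hscalar (continuousOn_mildFlow hD hG l₀) fun t ht => mildFlow_eq hD hG l₀ ht)
  intro t ht
  have ht' : (0 : ℝ) ≤ t := ht
  rw [heq t ht', mildFlow_eq hD hG l₀ ht']
  congr 2
  refine intervalIntegral.integral_congr fun s hs => ?_
  rw [uIcc_of_le ht'] at hs
  have := hu (mem_Ici.2 hs.1)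
  simp only at this
  simp only [this]

/-- The flow property of mild solutions. -/
theorem mildFlow_add [CompleteSpace Y] (hD : IsAdjointOrbit SY T D)
    (hG : IsDualSolution T D g w G) (l : StrongDual ℝ Y) {t τ : ℝ} (ht : 0 ≤ t) (hτ : 0 ≤ τ) :
    mildFlow SY D w G (mildFlow SY D w G l t) τ = mildFlow SY D w G l (t + τ) := by
  symm
  have hcont := continuousOn_mildFlow hD hG l
  -- By uniqueness it suffices that the shifted solution solves the mild equation started at time
  -- `t`.
  refine eqOn_mildFlow hD hG (l := fun r => mildFlow SY D w G l (t + r)) ?_ ?_ (mem_Ici.2 hτ)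
  · exact hcont.comp (by fun_prop) fun r hr => mem_Ici.2 (add_nonneg ht hr)
  · intro r hr
    have hint := intervalIntegrable_smul_kernel (add_nonneg ht hr) (hD.integrable (t + r))
      ((hG.continuousOn_apply l).mono Icc_subset_Ici_self)
    have hsub1 : uIcc 0 t ⊆ uIcc 0 (t + r) := by
      rw [uIcc_of_le ht, uIcc_of_le (add_nonneg ht hr)]
      exact Icc_subset_Icc_right (by linarith)
    have hsub2 : uIcc t (t + r) ⊆ uIcc 0 (t + r) := by
      rw [uIcc_of_le (by linarith), uIcc_of_le (add_nonneg ht hr)]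
      exact Icc_subset_Icc_left ht
    have h1 := intervalIntegral.integral_add_adjacent_intervals (hint.mono_set hsub1)
      (hint.mono_set hsub2)
    have h2 : ∫ s in (0 : ℝ)..t, l (G s) • D (t + r - s) =
        SY r (∫ s in (0 : ℝ)..t, l (G s) • D (t - s)) := by
      rw [← (SY r).intervalIntegral_comp_comm (intervalIntegrable_smul_kernel ht (hD.integrable t)
        ((hG.continuousOn_apply l).mono Icc_subset_Ici_self))]
      refine intervalIntegral.integral_congr_ae ?_
      -- The orbit identity for `D` holds only from positive times, so the endpoint `s = t` is
      -- discarded as a null set.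
      have hne : ∀ᵐ s : ℝ, s ≠ t := by simp [ae_iff]
      filter_upwards [hne] with s hs hmem
      rw [uIoc_of_le ht] at hmem
      rw [map_smul, ← hD.orbit r (t - s) hr (sub_pos.2 (lt_of_le_of_ne hmem.2 hs))]
      congr 2; ring
    have h3 : ∫ s in t..(t + r), l (G s) • D (t + r - s) =
        ∫ s in (0 : ℝ)..r, mildFlow SY D w G l (t + s) g • D (r - s) := by
      have := intervalIntegral.integral_comp_add_left (a := 0) (b := r)
        (fun s => l (G s) • D (t + r - s)) t
      rw [add_zero] at this
      rw [← this]
      refine intervalIntegral.integral_congr fun s hs => ?_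
      rw [uIcc_of_le hr] at hs
      simp only [mildFlow_apply_self hD hG l (add_nonneg ht hs.1), add_sub_add_left_eq_sub]
    rw [mildFlow, ← h1, h2, h3, mildFlow, map_sub, map_smul, add_comm t r,
      hD.semigroupY.add_apply hr ht, smul_add]
    abel

theorem norm_mildFlow_le (hD : IsAdjointOrbit SY T D) (hG : IsDualSolution T D g w G) (a : ℝ) :
    ∃ C : ℝ, 0 ≤ C ∧ ∀ l : StrongDual ℝ Y, ∀ t ∈ Icc 0 a, ‖mildFlow SY D w G l t‖ ≤ C * ‖l‖ := by
  obtain ⟨M, hM0, hM⟩ := hD.semigroupY.exists_bound a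
  obtain ⟨N, hN0, hN⟩ := hG.continuousOn.exists_bound_Icc a
  have hI : 0 ≤ ∫ s in Ioc 0 a, ‖D s‖ := integral_nonneg fun s => norm_nonneg _
  refine ⟨M + |w| * (N * ∫ s in Ioc 0 a, ‖D s‖), by positivity, fun l t ht => ?_⟩
  have h1 := norm_integral_smul_kernel_le (f := fun s => l (G s)) (H := ‖l‖ * N) ht.1 ht.2
    (hD.integrable a) (by positivity) fun s hs =>
      l.le_opNorm_of_le (hN s ⟨hs.1, hs.2.trans ht.2⟩)
  calc ‖mildFlow SY D w G l t‖ ≤ ‖SY t l‖ + ‖w • ∫ s in (0 : ℝ)..t, l (G s) • D (t - s)‖ :=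
        norm_sub_le _ _
    _ ≤ M * ‖l‖ + |w| * (‖l‖ * N * ∫ s in Ioc 0 a, ‖D s‖) := by
        rw [norm_smul, Real.norm_eq_abs]
        gcongr
        exact (SY t).le_of_opNorm_le (hM t ht) l
    _ = _ := by ring

end Flow

/-! ### Comparison of the flows for two coefficients -/

section Comparison

variable {Y : Type*} [NormedAddCommGroup Y] [NormedSpace ℝ Y] [CompleteSpace Y]
  {SY : ℝ → StrongDual ℝ Y →L[ℝ] StrongDual ℝ Y} {T : ℝ → Y →L[ℝ] Y}
  {D : ℝ → StrongDual ℝ Y} {g : Y} {w w' : ℝ} {G G' : ℝ → Y}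

omit [CompleteSpace Y] in
theorem intervalIntegrable_smul_mildFlow (hD : IsAdjointOrbit SY T D)
    (hG : IsDualSolution T D g w G) {f : ℝ → ℝ} (hf : ContinuousOn f (Ici 0))
    (m : StrongDual ℝ Y) {t : ℝ} (ht : 0 ≤ t) :
    IntervalIntegrable (fun s => f s • mildFlow SY D w G m (t - s)) volume 0 t :=
  intervalIntegrable_smul_kernel ht
    ((((continuousOn_mildFlow hD hG m).mono Icc_subset_Ici_self).integrableOn_Icc
      (a := 0) (b := t)).mono_set Ioc_subset_Icc_self) (hf.mono Icc_subset_Ici_self)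

omit [CompleteSpace Y] in
theorem apply_integral_smul_mildFlow (hD : IsAdjointOrbit SY T D)
    (hG : IsDualSolution T D g w G) {f : ℝ → ℝ} (hf : ContinuousOn f (Ici 0))
    (m : StrongDual ℝ Y) {t : ℝ} (ht : 0 ≤ t) (y : Y) :
    (∫ s in (0 : ℝ)..t, f s • mildFlow SY D w G m (t - s)) y =
      ∫ s in (0 : ℝ)..t, f s * mildFlow SY D w G m (t - s) y := by
  have h := (NormedSpace.inclusionInDoubleDual ℝ Y y).intervalIntegral_comp_comm
    (intervalIntegrable_smul_mildFlow hD hG hf m ht)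
  simp only [NormedSpace.dual_def, smul_apply, smul_eq_mul] at h
  exact h.symm

omit [CompleteSpace Y] in
/-- The integral of mild solutions started at `D u`, weighted by a continuous function. -/
theorem integral_smul_mildFlow (hD : IsAdjointOrbit SY T D) (hG : IsDualSolution T D g w G)
    {f : ℝ → ℝ} (hf : ContinuousOn f (Ici 0)) {u t : ℝ} (hu : 0 < u) (ht : 0 ≤ t) :
    ∫ s in (0 : ℝ)..t, f s • mildFlow SY D w G (D u) (t - s) =
      SY u (∫ s in (0 : ℝ)..t, f s • D (t - s)) -
        w • ∫ τ in (0 : ℝ)..t, (∫ s in (0 : ℝ)..τ, f s * D u (G (τ - s))) • D (t - τ) := by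
  have hR := hG.continuousOn_apply (D u)
  have hconv := continuousOn_smul_kernel hD.integrable hR
  have hfD := intervalIntegrable_smul_kernel ht (hD.integrable t)
    (hf.mono (Icc_subset_Ici_self : Icc 0 t ⊆ _))
  have hconvI : IntervalIntegrable
      (fun s => f s • ∫ σ in (0 : ℝ)..(t - s), D u (G σ) • D (t - s - σ)) volume 0 t :=
    intervalIntegrable_smul_kernel (D := fun t => ∫ σ in (0 : ℝ)..t, D u (G σ) • D (t - σ)) ht
      (((hconv.mono Icc_subset_Ici_self).integrableOn_Icc (a := 0) (b := t)).mono_set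
        Ioc_subset_Icc_self) (hf.mono Icc_subset_Ici_self)
  rw [← volterra_assoc ht (hD.integrable t) hf hR, ← (SY u).intervalIntegral_comp_comm hfD,
    ← intervalIntegral.integral_smul, ← intervalIntegral.integral_sub]
  · refine intervalIntegral.integral_congr_ae ?_
    have hne : ∀ᵐ s : ℝ, s ≠ t := by simp [ae_iff]
    filter_upwards [hne] with s hs hmem
    rw [uIoc_of_le ht] at hmem
    have hpos : 0 < t - s := sub_pos.2 (lt_of_le_of_ne hmem.2 hs)
    -- Both `SY (t - s) (D u)` and `SY u (D (t - s))` equal `D (u + (t - s))`; this lets `SY u` come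
    -- out of the integral.
    rw [mildFlow, smul_sub, map_smul, ← hD.orbit u _ hu.le hpos, ← hD.orbit _ u hpos.le hu,
      add_comm u, smul_comm w]
  · exact ⟨(SY u).integrable_comp hfD.1, (SY u).integrable_comp hfD.2⟩
  · exact hconvI.smul w

/-- Comparison of the mild solutions for two coefficients `w` and `w'`: variation of constants. -/
theorem tendsto_mildFlow_comparison (hD : IsAdjointOrbit SY T D) (hG : IsDualSolution T D g w G)
    (hG' : IsDualSolution T D g w' G') (l : StrongDual ℝ Y) {t : ℝ} (ht : 0 ≤ t) :
    Tendsto (fun u => mildFlow SY D w' G' l t +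
        (w' - w) • ∫ s in (0 : ℝ)..t, l (G s) • mildFlow SY D w' G' (D u) (t - s))
      (𝓝[>] 0) (𝓝 (mildFlow SY D w G l t)) := by
  have hh := hG.continuousOn_apply l
  obtain ⟨H, hH0, hH⟩ := hh.exists_bound_Icc t
  set δ : ℝ → ℝ := fun u => ∫ s in Ioc 0 t, ‖SY u (D s) - D s‖ with hδ
  set N : ℝ := ∫ s in Ioc 0 t, ‖D s‖ with hN
  have hN0 : 0 ≤ N := integral_nonneg fun s => norm_nonneg _
  set c : ℝ → StrongDual ℝ Y := fun τ => ∫ s in (0 : ℝ)..τ, l (G s) • D (τ - s) with hc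
  have hcδ : ∀ u, ∀ τ ∈ Icc 0 t, ‖SY u (c τ) - c τ‖ ≤ H * δ u := by
    intro u τ hτ
    have hi := intervalIntegrable_smul_kernel hτ.1 (hD.integrable τ)
      (hh.mono (Icc_subset_Ici_self : Icc 0 τ ⊆ _))
    have h1 := norm_integral_smul_kernel_le (E := fun s => SY u (D s) - D s)
      (f := fun s => l (G s)) hτ.1 hτ.2
      (((SY u).integrable_comp (hD.integrable t)).sub (hD.integrable t)) hH0
      fun s hs => hH s ⟨hs.1, hs.2.trans hτ.2⟩
    have h2 : SY u (c τ) - c τ =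
        ∫ s in (0 : ℝ)..τ, l (G s) • (SY u (D (τ - s)) - D (τ - s)) := by
      rw [hc]
      simp only
      rw [← (SY u).intervalIntegral_comp_comm hi, ← intervalIntegral.integral_sub _ hi]
      · simp only [map_smul, smul_sub]
      · exact ⟨(SY u).integrable_comp hi.1, (SY u).integrable_comp hi.2⟩
    rw [h2]
    exact h1
  -- The variation-of-constants expression with `D u` in place of `ν`; below, `e` is its error after
  -- pairing with `g`.
  set X : ℝ → ℝ → StrongDual ℝ Y := fun u τ => mildFlow SY D w' G' l τ +
    (w' - w) • ∫ s in (0 : ℝ)..τ, l (G s) • mildFlow SY D w' G' (D u) (τ - s) with hX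
  have hXc : ∀ u, ContinuousOn (X u) (Ici 0) := fun u => by
    have hI : ContinuousOn (fun τ => ∫ s in (0 : ℝ)..τ,
        l (G s) • mildFlow SY D w' G' (D u) (τ - s)) (Ici 0) := by
      refine continuousOn_smul_kernel (fun a => ?_) hh
      exact (((continuousOn_mildFlow hD hG' (D u)).mono Icc_subset_Ici_self).integrableOn_Icc
        (a := 0) (b := a)).mono_set Ioc_subset_Icc_self
    exact (continuousOn_mildFlow hD hG' l).add (hI.const_smul (w' - w))
  set e : ℝ → ℝ → ℝ := fun u τ => X u τ g - l (G τ) with he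
  have hec : ∀ u, ContinuousOn (e u) (Ici 0) := fun u =>
    ((hXc u).clm_apply continuousOn_const).sub hh
  have hXg : ∀ u τ, 0 ≤ τ → X u τ g =
      l (G' τ) + (w' - w) * ∫ s in (0 : ℝ)..τ, l (G s) * D u (G' (τ - s)) := by
    intro u τ hτ
    rw [hX]
    simp only
    rw [add_apply, smul_apply, apply_integral_smul_mildFlow hD hG' hh _ hτ,
      mildFlow_apply_self hD hG' l hτ, smul_eq_mul]
    congr 2
    refine intervalIntegral.integral_congr fun s hs => ?_
    rw [uIcc_of_le hτ] at hs
    simp only [mildFlow_apply_self hD hG' _ (sub_nonneg.2 hs.2)]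
  -- The error solves the mild equation for `w'` with forcing `(w' - w) • (SY u (c τ) - c τ)`, which
  -- is small by `hcδ`.
  have hdiff : ∀ u, 0 < u → ∀ τ, 0 ≤ τ → X u τ - mildFlow SY D w G l τ =
      (w' - w) • (SY u (c τ) - c τ) - w' • ∫ s in (0 : ℝ)..τ, e u s • D (τ - s) := by
    intro u hu τ hτ
    have hl' := hG'.continuousOn_apply l
    have hi1 := intervalIntegrable_smul_kernel hτ (hD.integrable τ)
      (hh.mono (Icc_subset_Ici_self : Icc 0 τ ⊆ _))
    have hi2 := intervalIntegrable_smul_kernel hτ (hD.integrable τ)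
      (hl'.mono (Icc_subset_Ici_self : Icc 0 τ ⊆ _))
    have hi3 : IntervalIntegrable (fun s =>
        (∫ r in (0 : ℝ)..s, l (G r) * D u (G' (s - r))) • D (τ - s)) volume 0 τ := by
      refine intervalIntegrable_smul_kernel hτ (hD.integrable τ) (ContinuousOn.mono ?_
        (Icc_subset_Ici_self : Icc 0 τ ⊆ _))
      refine continuousOn_smul_kernel (D := fun s => D u (G' s)) (fun a => ?_) hh
      exact (((hG'.continuousOn_apply (D u)).mono Icc_subset_Ici_self).integrableOn_Icc
        (a := 0) (b := a)).mono_set Ioc_subset_Icc_self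
    have hi4 : IntervalIntegrable (fun s => (w' - w) •
        (∫ r in (0 : ℝ)..s, l (G r) * D u (G' (s - r))) • D (τ - s)) volume 0 τ :=
      hi3.smul (w' - w)
    have hE : ∫ s in (0 : ℝ)..τ, e u s • D (τ - s) =
        (∫ s in (0 : ℝ)..τ, l (G' s) • D (τ - s)) +
        (w' - w) • (∫ s in (0 : ℝ)..τ,
          (∫ r in (0 : ℝ)..s, l (G r) * D u (G' (s - r))) • D (τ - s)) - c τ := by
      rw [hc]
      simp only
      rw [← intervalIntegral.integral_smul, ← intervalIntegral.integral_add hi2 hi4,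
        ← intervalIntegral.integral_sub (hi2.add hi4) hi1]
      refine intervalIntegral.integral_congr fun s hs => ?_
      rw [uIcc_of_le hτ] at hs
      simp only [he, hXg u s hs.1]
      module
    have hM : mildFlow SY D w G l τ = SY τ l - w • c τ := rfl
    rw [hE, hM, hX]
    beta_reduce
    rw [integral_smul_mildFlow hD hG' hh hu hτ, mildFlow]
    change _ + (w' - w) • (SY u (c τ) - _) - _ = _
    module
  -- Scalar stability bounds `e` by the forcing, with `K` independent of `u`; reinserting `e` in
  -- `hdiff` bounds the error in norm.
  obtain ⟨K, hK0, hK⟩ := volterra_stability (V := ℝ) (hD.integrable_kernel w' g t)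
  have heb : ∀ u, 0 < u → ∀ τ ∈ Icc 0 t, ‖e u τ‖ ≤ K * (|w' - w| * (H * δ u) * ‖g‖) := by
    intro u hu
    refine hK (e u) (fun τ => ((w' - w) • (SY u (c τ) - c τ)) g) _
      ((hec u).mono Icc_subset_Ici_self) (fun τ hτ => ?_) (fun τ hτ => ?_)
    · refine ContinuousLinearMap.le_of_opNorm_le _ ?_ g
      rw [norm_smul, Real.norm_eq_abs]
      gcongr
      exact hcδ u τ hτ
    · have h1 := congrArg (fun m : StrongDual ℝ Y => m g) (hdiff u hu τ hτ.1)
      have h3 : (w' • ∫ s in (0 : ℝ)..τ, e u s • D (τ - s)) g =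
        w' * (∫ s in (0 : ℝ)..τ, e u s • D (τ - s)) g := rfl
      rw [sub_apply, sub_apply, mildFlow_apply_self hD hG l hτ.1, h3, hD.eval_integral hτ.1 (hec u)] at h1
      rw [he] at h1 ⊢
      simp only at h1 ⊢
      rw [h1, sub_eq_add_neg, ← neg_mul, ← intervalIntegral.integral_const_mul]
      congr 2
      funext s
      rw [smul_eq_mul]; ring
  have hbd : ∀ u, 0 < u → ‖X u t - mildFlow SY D w G l t‖ ≤
      |w' - w| * (H * δ u) + |w'| * (K * (|w' - w| * (H * δ u) * ‖g‖) * N) := by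
    intro u hu
    have hδ0 : 0 ≤ δ u := integral_nonneg fun s => norm_nonneg _
    rw [hdiff u hu t ht]
    refine (norm_sub_le _ _).trans ?_
    rw [norm_smul, norm_smul, Real.norm_eq_abs, Real.norm_eq_abs]
    gcongr
    · exact hcδ u t ⟨ht, le_rfl⟩
    · exact norm_integral_smul_kernel_le ht le_rfl (hD.integrable t) (by positivity)
        fun s hs => heb u hu s hs
  have hlim : Tendsto (fun u => |w' - w| * (H * δ u) +
      |w'| * (K * (|w' - w| * (H * δ u) * ‖g‖) * N)) (𝓝[>] 0) (𝓝 0) := by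
    have h0 := hD.tendsto_integral_norm_sub t
    have h1 := (h0.const_mul H).const_mul |w' - w|
    have h2 := (((h1.mul_const ‖g‖).const_mul K).mul_const N).const_mul |w'|
    simpa using h1.add h2
  rw [tendsto_iff_norm_sub_tendsto_zero]
  exact squeeze_zero' (Eventually.of_forall fun _ => norm_nonneg _)
    (eventually_nhdsWithin_of_forall fun u hu => hbd u hu) hlim

end Comparison

/-! ### Pre-adjoints of weak-* continuous operators -/

section Preadjoint

variable {Y : Type*} [NormedAddCommGroup Y] [NormedSpace ℝ Y]

/-- The dual of `Y*` for the weak-* topology is `Y`. -/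
theorem WeakDual.exists_eq_eval (φ : WeakDual ℝ Y →L[ℝ] ℝ) :
    ∃ y : Y, ∀ l : WeakDual ℝ Y, φ l = l y := by
  obtain ⟨y, hy⟩ := LinearMap.dualEmbedding_surjective (topDualPairing ℝ Y) φ
  exact ⟨y, fun l => (DFunLike.congr_fun hy l).symm⟩

/-- A bounded operator on `Y*` which is weak-* continuous is the adjoint of a bounded operator. -/
theorem exists_preadjoint {A : StrongDual ℝ Y →L[ℝ] StrongDual ℝ Y}
    (hA : Continuous fun l : WeakDual ℝ Y => StrongDual.toWeakDual (A (WeakDual.toStrongDual l))) :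
    ∃ B : Y →L[ℝ] Y, (∀ (l : StrongDual ℝ Y) (y : Y), A l y = l (B y)) ∧ ‖B‖ ≤ ‖A‖ := by
  have h : ∀ y : Y, ∃ z : Y, ∀ l : StrongDual ℝ Y, A l y = l z := by
    intro y
    let φ : WeakDual ℝ Y →L[ℝ] ℝ :=
      { toFun := fun l => A (WeakDual.toStrongDual l) y
        map_add' := fun l m => by simp
        map_smul' := fun c l => by simp
        cont := (WeakDual.eval_continuous y).comp hA }
    obtain ⟨z, hz⟩ := WeakDual.exists_eq_eval φ
    exact ⟨z, fun l => hz (StrongDual.toWeakDual l)⟩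
  choose b hb using h
  have hext : ∀ {x z : Y}, (∀ l : StrongDual ℝ Y, l x = l z) → x = z := fun h =>
    (SeparatingDual.eq_iff_forall_dual_eq (R := ℝ)).2 h
  have hnorm : ∀ y, ‖b y‖ ≤ ‖A‖ * ‖y‖ := fun y => by
    refine NormedSpace.norm_le_dual_bound ℝ _ (by positivity) fun l => ?_
    rw [← hb]
    calc ‖A l y‖ ≤ ‖A l‖ * ‖y‖ := (A l).le_opNorm y
      _ ≤ ‖A‖ * ‖l‖ * ‖y‖ := by gcongr; exact A.le_opNorm l
      _ = _ := by ring
  let B₀ : Y →ₗ[ℝ] Y :=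
    { toFun := b
      map_add' := fun x y => hext fun l => by rw [map_add, ← hb, ← hb, ← hb, map_add]
      map_smul' := fun c x => hext fun l => by
        rw [map_smul, ← hb, ← hb, map_smul, RingHom.id_apply] }
  exact ⟨B₀.mkContinuous ‖A‖ hnorm, fun l y => hb y l,
    B₀.mkContinuous_norm_le (norm_nonneg A) hnorm⟩

/-- A strongly continuous semigroup of weak-* continuous operators on `Y*` is adjoint to a strongly
continuous semigroup on `Y`. -/
theorem exists_preadjoint_semigroup [CompleteSpace Y]
    {SY : ℝ → StrongDual ℝ Y →L[ℝ] StrongDual ℝ Y} (hS : IsStronglyContinuousSemigroup SY)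
    (hw : ∀ t : ℝ, 0 ≤ t → Continuous fun l : WeakDual ℝ Y =>
      StrongDual.toWeakDual (SY t (WeakDual.toStrongDual l))) :
    ∃ T : ℝ → Y →L[ℝ] Y, IsStronglyContinuousSemigroup T ∧
      ∀ t : ℝ, 0 ≤ t → ∀ (l : StrongDual ℝ Y) (y : Y), SY t l y = l (T t y) := by
  have h : ∀ t : ℝ, ∃ B : Y →L[ℝ] Y, 0 ≤ t →
      (∀ (l : StrongDual ℝ Y) (y : Y), SY t l y = l (B y)) ∧ ‖B‖ ≤ ‖SY t‖ := by
    intro t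
    by_cases ht : 0 ≤ t
    · obtain ⟨B, hB⟩ := exists_preadjoint (hw t ht)
      exact ⟨B, fun _ => hB⟩
    · exact ⟨0, fun h => absurd h ht⟩
  choose T hT using h
  have hadj : ∀ t : ℝ, 0 ≤ t → ∀ (l : StrongDual ℝ Y) (y : Y), SY t l y = l (T t y) :=
    fun t ht => (hT t ht).1
  refine ⟨T, isStronglyContinuousSemigroup_of_weak ?_ ?_ ?_ ?_, hadj⟩
  · ext y
    refine (SeparatingDual.eq_iff_forall_dual_eq (R := ℝ)).2 fun l => ?_
    rw [← hadj 0 le_rfl, hS.zero_apply]; rfl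
  · intro s t hs ht
    ext y
    refine (SeparatingDual.eq_iff_forall_dual_eq (R := ℝ)).2 fun l => ?_
    rw [← hadj _ (add_nonneg hs ht), add_comm, hS.add_apply ht hs, hadj t ht, hadj s hs]
    rfl
  -- Norm continuity of the adjoint orbit `SY t l` is more than weak continuity of `T t v` requires.
  · intro l v
    refine ((hS.continuousOn_orbit l).clm_apply (continuousOn_const (c := v))).congr ?_
    exact fun t ht => (hadj t ht l v).symm
  · intro a
    obtain ⟨M, hM0, hM⟩ := hS.exists_bound a
    exact ⟨M, hM0, fun t ht => (hT t ht.1).2.trans (hM t ht)⟩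

end Preadjoint

/-! ### The lift setting -/

section LiftSetting

variable {Z Y : Type*} [NormedAddCommGroup Z] [NormedSpace ℝ Z]
  [NormedAddCommGroup Y] [NormedSpace ℝ Y]
  {ι : Z →L[ℝ] Y} {SY : ℝ → StrongDual ℝ Y →L[ℝ] StrongDual ℝ Y}
  {SZ : ℝ → StrongDual ℝ Z →L[ℝ] StrongDual ℝ Z} {ν : StrongDual ℝ Z} {g : Y} {w : ℝ}

theorem dualRestrict_damped (hreg : IsRegularizing ι SZ ν) {t : ℝ} (ht : 0 < t) :
    dualRestrict ι (damped ι SZ ν t) = SZ t ν :=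
  Function.invFun_eq (hreg.mem t ht)

/-- The semigroup law holds in `Z*` and is pulled back along the injection of `Y*`. -/
theorem damped_add (hset : IsLiftSetting ι SY SZ) (hreg : IsRegularizing ι SZ ν) {u s : ℝ}
    (hu : 0 ≤ u) (hs : 0 < s) : damped ι SZ ν (u + s) = SY u (damped ι SZ ν s) := by
  apply hset.dual_embedding
  rw [dualRestrict_damped hreg (by linarith), hset.compatible u hu, dualRestrict_damped hreg hs,
    hset.semigroupZ.add_apply hu hs.le]

/-- Near `t > 0` the curve is the `Y*`-orbit of its value at `t / 2`. -/
theorem continuousOn_damped (hset : IsLiftSetting ι SY SZ) (hreg : IsRegularizing ι SZ ν) :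
    ContinuousOn (damped ι SZ ν) (Ioi 0) := by
  intro t ht
  have ht' : (0 : ℝ) < t := ht
  have h1 : ContinuousOn (fun s => SY (s - t / 2) (damped ι SZ ν (t / 2))) (Ici (t / 2)) :=
    (hset.semigroupY.continuousOn_orbit _).comp (by fun_prop)
      fun s hs => mem_Ici.2 (sub_nonneg.2 hs)
  have h2 : ContinuousOn (damped ι SZ ν) (Ici (t / 2)) := h1.congr fun s hs => by
    beta_reduce
    rw [← damped_add hset hreg (sub_nonneg.2 hs) (by linarith), sub_add_cancel]
  exact (h2.continuousAt (Ici_mem_nhds (by linarith))).continuousWithinAt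

/-- Square integrability suffices on a bounded interval, since `x ≤ x ^ 2 + 1`. -/
theorem integrableOn_damped (hset : IsLiftSetting ι SY SZ) (hreg : IsRegularizing ι SZ ν) (t : ℝ) :
    IntegrableOn (damped ι SZ ν) (Ioc 0 t) := by
  rcases le_or_gt t 0 with ht | ht
  · simp [Ioc_eq_empty (not_lt.2 ht)]
  have hm : AEStronglyMeasurable (damped ι SZ ν) (volume.restrict (Ioc 0 t)) :=
    ((continuousOn_damped hset hreg).mono Ioc_subset_Ioi_self).aestronglyMeasurable
      measurableSet_Ioc
  refine Integrable.mono' ((hreg.sq_integrable t ht).add (integrable_const (1 : ℝ))) hm ?_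
  refine Eventually.of_forall fun s => ?_
  simp only [Pi.add_apply]
  nlinarith [sq_nonneg (‖damped ι SZ ν s‖ - 1)]

theorem exists_isAdjointOrbit [CompleteSpace Y] (hset : IsLiftSetting ι SY SZ)
    (hreg : IsRegularizing ι SZ ν) :
    ∃ T : ℝ → Y →L[ℝ] Y, IsAdjointOrbit SY T (damped ι SZ ν) := by
  obtain ⟨T, hT, hadj⟩ := exists_preadjoint_semigroup hset.semigroupY hset.weakStarY
  exact ⟨T, hset.semigroupY, hT, hadj, fun u s hu hs => damped_add hset hreg hu hs,
    integrableOn_damped hset hreg⟩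

variable [CompleteSpace Y] {T : ℝ → Y →L[ℝ] Y} {G : ℝ → Y}

theorem isMildSolution_mildFlow (hD : IsAdjointOrbit SY T (damped ι SZ ν))
    (hG : IsDualSolution T (damped ι SZ ν) g w G) (l₀ : StrongDual ℝ Y) :
    IsMildSolution ι SY SZ ν g w l₀ (mildFlow SY (damped ι SZ ν) w G l₀) where
  continuousOn := continuousOn_mildFlow hD hG l₀
  integrable _ ht := intervalIntegrable_smul_kernel ht (hD.integrable _)
    (((continuousOn_mildFlow hD hG l₀).clm_apply continuousOn_const).mono Icc_subset_Ici_self)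
  eq _ ht := mildFlow_eq hD hG l₀ ht

theorem IsMildSolution.eqOn_mildFlow (hD : IsAdjointOrbit SY T (damped ι SZ ν))
    (hG : IsDualSolution T (damped ι SZ ν) g w G) {l₀ : StrongDual ℝ Y} {l : ℝ → StrongDual ℝ Y}
    (hl : IsMildSolution ι SY SZ ν g w l₀ l) :
    EqOn l (mildFlow SY (damped ι SZ ν) w G l₀) (Ici 0) :=
  _root_.eqOn_mildFlow hD hG hl.continuousOn hl.eq

/-- Since `⟨g, λ_t⟩ = λ_0(G_t)`, the cone is the dual cone of the curve `G`. -/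
theorem mem_coneEw_iff (hD : IsAdjointOrbit SY T (damped ι SZ ν))
    (hG : IsDualSolution T (damped ι SZ ν) g w G) (l₀ : WeakDual ℝ Y) :
    l₀ ∈ coneEw ι SY SZ ν g w ↔ ∀ t : ℝ, 0 ≤ t → 0 ≤ l₀ (G t) := by
  constructor
  · rintro ⟨l, hl, hpos⟩ t ht
    have h1 := hpos t ht
    rw [hl.eqOn_mildFlow hD hG (mem_Ici.2 ht), mildFlow_apply_self hD hG _ ht] at h1
    exact h1
  · intro h
    refine ⟨_, isMildSolution_mildFlow hD hG _, fun t ht => ?_⟩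
    rw [mildFlow_apply_self hD hG _ ht]
    exact h t ht

end LiftSetting

/-! ### Positivity cones for different coefficients -/

section Positivity

variable {Y : Type*} [NormedAddCommGroup Y] [NormedSpace ℝ Y] [CompleteSpace Y]
  {SY : ℝ → StrongDual ℝ Y →L[ℝ] StrongDual ℝ Y} {T : ℝ → Y →L[ℝ] Y}
  {D : ℝ → StrongDual ℝ Y} {g : Y} {w w' : ℝ} {G G' : ℝ → Y}

/-- Evolving `l` amounts to shifting `G` in time, so the dual cone of `G` is invariant under the
flow with the same coefficient. -/
theorem mildFlow_apply_dualSolution (hD : IsAdjointOrbit SY T D) (hG : IsDualSolution T D g w G)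
    (l : StrongDual ℝ Y) {t τ : ℝ} (ht : 0 ≤ t) (hτ : 0 ≤ τ) :
    mildFlow SY D w G l t (G τ) = l (G (t + τ)) := by
  rw [← mildFlow_apply_self hD hG _ hτ, mildFlow_add hD hG l ht hτ,
    mildFlow_apply_self hD hG l (add_nonneg ht hτ)]

theorem tendsto_comparison_apply (hD : IsAdjointOrbit SY T D) (hG : IsDualSolution T D g w G)
    (hG' : IsDualSolution T D g w' G') (l : StrongDual ℝ Y) {t : ℝ} (ht : 0 ≤ t) (y : Y) :
    Tendsto (fun u => mildFlow SY D w' G' l t y +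
        (w' - w) * ∫ s in (0 : ℝ)..t, l (G s) * mildFlow SY D w' G' (D u) (t - s) y)
      (𝓝[>] 0) (𝓝 (mildFlow SY D w G l t y)) := by
  have h := ((NormedSpace.inclusionInDoubleDual ℝ Y y).continuous.tendsto _).comp
    (tendsto_mildFlow_comparison hD hG hG' l ht)
  refine h.congr fun u => ?_
  simp only [Function.comp_apply, NormedSpace.dual_def, add_apply]
  rw [← apply_integral_smul_mildFlow hD hG' (hG.continuousOn_apply l) _ ht]
  rfl

/-- Positivity of `⟨g, λ⟩` for the coefficient `w` implies positivity for smaller `w'`. -/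
theorem nonneg_dualSolution_of_le (hD : IsAdjointOrbit SY T D) (hG : IsDualSolution T D g w G)
    (hG' : IsDualSolution T D g w' G') (hw : w' ≤ w)
    (hpos : ∀ u : ℝ, 0 < u → ∀ t : ℝ, 0 ≤ t → 0 ≤ D u (G' t))
    {l : StrongDual ℝ Y} (hl : ∀ t : ℝ, 0 ≤ t → 0 ≤ l (G t)) {t : ℝ} (ht : 0 ≤ t) :
    0 ≤ l (G' t) := by
  have h := tendsto_comparison_apply hD hG hG' l ht g
  rw [mildFlow_apply_self hD hG l ht] at h
  -- As `w' - w ≤ 0`, the correction term is nonpositive: each approximation, and hence the limit `l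
  -- (G t)`, is at most `l (G' t)`.
  refine (hl t ht).trans (le_of_tendsto h (eventually_nhdsWithin_of_forall fun u hu => ?_))
  rw [mildFlow_apply_self hD hG' l ht]
  have hI : 0 ≤ ∫ s in (0 : ℝ)..t, l (G s) * mildFlow SY D w' G' (D u) (t - s) g := by
    refine intervalIntegral.integral_nonneg ht fun s hs => mul_nonneg (hl s hs.1) ?_
    rw [mildFlow_apply_self hD hG' _ (sub_nonneg.2 hs.2)]
    exact hpos u hu _ (sub_nonneg.2 hs.2)
  have := mul_nonpos_of_nonpos_of_nonneg (sub_nonpos.2 hw) hI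
  linarith

/-- The mild solution for the coefficient `w` stays in the positivity cone of a larger `w'`. -/
theorem nonneg_mildFlow_dualSolution_of_le (hD : IsAdjointOrbit SY T D)
    (hG : IsDualSolution T D g w G) (hG' : IsDualSolution T D g w' G') (hw : w ≤ w')
    (hpos : ∀ u : ℝ, 0 < u → ∀ t : ℝ, 0 ≤ t → 0 ≤ D u (G' t))
    {l : StrongDual ℝ Y} (hl : ∀ t : ℝ, 0 ≤ t → 0 ≤ l (G t))
    (hl' : ∀ t : ℝ, 0 ≤ t → 0 ≤ l (G' t)) {t τ : ℝ} (ht : 0 ≤ t) (hτ : 0 ≤ τ) :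
    0 ≤ mildFlow SY D w G l t (G' τ) := by
  have h := tendsto_comparison_apply hD hG hG' l ht (G' τ)
  refine ge_of_tendsto h (eventually_nhdsWithin_of_forall fun u hu => ?_)
  have hI : 0 ≤ ∫ s in (0 : ℝ)..t, l (G s) * mildFlow SY D w' G' (D u) (t - s) (G' τ) := by
    refine intervalIntegral.integral_nonneg ht fun s hs => mul_nonneg (hl s hs.1) ?_
    rw [mildFlow_apply_dualSolution hD hG' _ (sub_nonneg.2 hs.2) hτ]
    exact hpos u hu _ (add_nonneg (sub_nonneg.2 hs.2) hτ)
  rw [mildFlow_apply_dualSolution hD hG' l ht hτ]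
  exact add_nonneg (hl' _ (add_nonneg ht hτ)) (mul_nonneg (sub_nonneg.2 hw) hI)

theorem continuous_mildFlow_weakDual (hD : IsAdjointOrbit SY T D)
    (hG : IsDualSolution T D g w G) {t : ℝ} (ht : 0 ≤ t) :
    Continuous fun l : WeakDual ℝ Y =>
      StrongDual.toWeakDual (mildFlow SY D w G (WeakDual.toStrongDual l) t) := by
  refine WeakDual.continuous_of_continuous_eval fun y => ?_
  have : (fun l : WeakDual ℝ Y =>
      StrongDual.toWeakDual (mildFlow SY D w G (WeakDual.toStrongDual l) t) y) =
      fun l : WeakDual ℝ Y => l (T t y - w • ∫ s in (0 : ℝ)..t, D (t - s) y • G s) :=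
    funext fun l => mildFlow_apply hD hG (WeakDual.toStrongDual l) ht y
  rw [this]
  exact WeakDual.eval_continuous _

end Positivity

/-! ### Generalized Feller semigroups from deterministic flows -/

section Feller

variable {X : Type*} [TopologicalSpace X] {ρ : X → Ioi (0 : ℝ)}

omit [TopologicalSpace X] in
theorem rhoNorm_nonneg (f : X → ℝ) : 0 ≤ rhoNorm ρ f :=
  Real.iSup_nonneg fun x => div_nonneg (abs_nonneg _) (le_of_lt (ρ x).2)

theorem abs_le_rhoNorm_mul (f : Brho ρ) (x : X) :
    |(f : X → ℝ) x| ≤ rhoNorm ρ f * (ρ x : ℝ) := by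
  obtain ⟨⟨C, hC⟩, -⟩ := f.2
  have hρ : ∀ x, 0 < (ρ x : ℝ) := fun x => (ρ x).2
  rw [← div_le_iff₀ (hρ x)]
  refine le_ciSup (f := fun x => |(f : X → ℝ) x| / (ρ x : ℝ)) ⟨C, ?_⟩ x
  rintro _ ⟨y, rfl⟩
  exact (div_le_iff₀ (hρ y)).2 (hC y)

/-- Composition with a continuous map along which the weight grows at most by a factor. -/
noncomputable def Brho.compLinear (φ : X → X) (hφ : Continuous φ) (C : ℝ) (hC : 0 < C)
    (hρ : ∀ x, (ρ (φ x) : ℝ) ≤ C * ρ x) : Brho ρ →ₗ[ℝ] Brho ρ where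
  toFun f := ⟨fun x => (f : X → ℝ) (φ x), by
    obtain ⟨⟨K, hK⟩, happ⟩ := f.2
    refine ⟨⟨|K| * C, fun x => ?_⟩, fun ε hε => ?_⟩
    · calc |(f : X → ℝ) (φ x)| ≤ K * ρ (φ x) := hK _
        _ ≤ |K| * (ρ (φ x) : ℝ) := mul_le_mul_of_nonneg_right (le_abs_self K) (le_of_lt (ρ _).2)
        _ ≤ |K| * (C * ρ x) := mul_le_mul_of_nonneg_left (hρ x) (abs_nonneg K)
        _ = |K| * C * ρ x := by ring
    · obtain ⟨h, hh⟩ := happ (ε / C) (div_pos hε hC)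
      refine ⟨h.compContinuous ⟨φ, hφ⟩, fun x => ?_⟩
      calc |(f : X → ℝ) (φ x) - h (φ x)| ≤ ε / C * ρ (φ x) := hh _
        _ ≤ ε / C * (C * ρ x) := mul_le_mul_of_nonneg_left (hρ x) (div_pos hε hC).le
        _ = ε * ρ x := by field_simp⟩
  map_add' f h := rfl
  map_smul' c f := rfl

theorem rhoNorm_le_of_comp {φ : X → X} {C : ℝ} (hC : 0 ≤ C)
    (hρ : ∀ x, (ρ (φ x) : ℝ) ≤ C * ρ x) (f : Brho ρ) {h : X → ℝ}
    (hh : ∀ x, h x = (f : X → ℝ) (φ x)) : rhoNorm ρ h ≤ C * rhoNorm ρ f := by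
  refine Real.iSup_le (fun x => ?_) (mul_nonneg hC (rhoNorm_nonneg _))
  have hx : 0 < (ρ x : ℝ) := (ρ x).2
  rw [div_le_iff₀ hx, hh]
  calc |(f : X → ℝ) (φ x)| ≤ rhoNorm ρ f * ρ (φ x) := abs_le_rhoNorm_mul f _
    _ ≤ rhoNorm ρ f * (C * ρ x) := mul_le_mul_of_nonneg_left (hρ x) (rhoNorm_nonneg _)
    _ = _ := by ring

/-- Functions in `𝓑^ρ(X)` are continuous along curves on which the weight stays bounded. -/
theorem Brho.tendsto_apply (f : Brho ρ) {α : Type*} {F : Filter α} {c : α → X} {x : X}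
    (hc : Tendsto c F (𝓝 x)) {R : ℝ} (hR : ∀ᶠ a in F, (ρ (c a) : ℝ) ≤ R) :
    Tendsto (fun a => (f : X → ℝ) (c a)) F (𝓝 ((f : X → ℝ) x)) := by
  rw [Metric.tendsto_nhds]
  intro ε hε
  have hx : 0 < (ρ x : ℝ) := (ρ x).2
  -- `S` bounds `ρ (c a) + ρ x`, so the two approximation errors together cost at most `ε / 2`.
  set S : ℝ := |R| + ρ x with hS
  have hS0 : 0 < S := by positivity
  obtain ⟨h, hh⟩ := f.2.2 (ε / (2 * S)) (by positivity)
  have hcont : Tendsto (fun a => h (c a)) F (𝓝 (h x)) := (h.continuous.tendsto x).comp hc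
  filter_upwards [hR, Metric.tendsto_nhds.1 hcont (ε / 2) (by positivity)] with a ha hd
  rw [Real.dist_eq] at hd ⊢
  have h1 := hh (c a)
  have h2 := hh x
  rw [abs_sub_comm] at h2
  have h3 : (f : X → ℝ) (c a) - (f : X → ℝ) x =
      ((f : X → ℝ) (c a) - h (c a)) + (h x - (f : X → ℝ) x) + (h (c a) - h x) := by ring
  have h4 : ε / (2 * S) * ρ (c a) + ε / (2 * S) * ρ x ≤ ε / 2 := by
    calc ε / (2 * S) * ρ (c a) + ε / (2 * S) * ρ x = ε / (2 * S) * (ρ (c a) + ρ x) := by ring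
      _ ≤ ε / (2 * S) * S := by
          gcongr
          exact add_le_add (ha.trans (le_abs_self R)) le_rfl
      _ = ε / 2 := by field_simp
  rw [h3]
  have h5 := abs_add_three ((f : X → ℝ) (c a) - h (c a)) (h x - (f : X → ℝ) x) (h (c a) - h x)
  linarith

/-- A continuous flow along which the weight grows locally boundedly induces a generalized Feller
semigroup. -/
theorem exists_generalizedFellerSemigroup_of_flow (Φ : ℝ → X → X)
    (zero : ∀ x, Φ 0 x = x)
    (add : ∀ s t : ℝ, 0 ≤ s → 0 ≤ t → ∀ x, Φ (t + s) x = Φ s (Φ t x))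
    (cont : ∀ t : ℝ, 0 ≤ t → Continuous (Φ t))
    (growth : ∀ a : ℝ, ∃ C : ℝ, 0 < C ∧ ∀ t ∈ Icc 0 a, ∀ x, (ρ (Φ t x) : ℝ) ≤ C * ρ x)
    (tend : ∀ x, Tendsto (fun t => Φ t x) (𝓝[>] 0) (𝓝 x)) :
    ∃ P : ℝ → Brho ρ →ₗ[ℝ] Brho ρ, IsGeneralizedFellerSemigroup ρ P ∧
      ∀ t : ℝ, 0 ≤ t → ∀ (f : Brho ρ) (x : X), (P t f : X → ℝ) x = (f : X → ℝ) (Φ t x) := by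
  have hgr : ∀ t : ℝ, ∃ C : ℝ, 0 < C ∧ ∀ x, (ρ (Φ (max t 0) x) : ℝ) ≤ C * ρ x := fun t => by
    obtain ⟨C, hC, h⟩ := growth (max t 0)
    exact ⟨C, hC, h _ ⟨le_max_right _ _, le_rfl⟩⟩
  choose C hC hCρ using hgr
  set P : ℝ → Brho ρ →ₗ[ℝ] Brho ρ := fun t =>
    Brho.compLinear (Φ (max t 0)) (cont _ (le_max_right _ _)) (C t) (hC t) (hCρ t) with hPdef
  have hP : ∀ t : ℝ, 0 ≤ t → ∀ (f : Brho ρ) (x : X),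
      (P t f : X → ℝ) x = (f : X → ℝ) (Φ t x) := by
    intro t ht f x
    have : (P t f : X → ℝ) x = (f : X → ℝ) (Φ (max t 0) x) := rfl
    rw [this, max_eq_left ht]
  have hPn : ∀ a : ℝ, ∃ K : ℝ, ∀ t ∈ Icc 0 a, ∀ f : Brho ρ,
      rhoNorm ρ (P t f) ≤ K * rhoNorm ρ f := by
    intro a
    obtain ⟨K, hK, h⟩ := growth a
    exact ⟨K, fun t ht f => rhoNorm_le_of_comp hK.le (h t ht) f (hP t ht.1 f)⟩
  refine ⟨P, ⟨fun t ht => ?_, ?_, fun s t hs ht => ?_, fun f x => ?_, ?_, fun t ht f hf x => ?_⟩,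
    hP⟩
  · obtain ⟨K, hK⟩ := hPn t
    exact ⟨K, hK t ⟨ht, le_rfl⟩⟩
  · ext f x
    rw [hP 0 le_rfl, zero]; rfl
  · ext f x
    rw [hP _ (add_nonneg ht hs), LinearMap.comp_apply, hP t ht, hP s hs, add s t hs ht]
  · obtain ⟨K, -, hK⟩ := growth 1
    have hbd : ∀ᶠ t : ℝ in 𝓝[>] 0, (ρ (Φ t x) : ℝ) ≤ K * ρ x := by
      filter_upwards [Ioc_mem_nhdsGT one_pos] with t ht using hK t (Ioc_subset_Icc_self ht) x
    refine (Brho.tendsto_apply f (tend x) hbd).congr' ?_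
    exact eventually_nhdsWithin_of_forall fun t ht => (hP t (le_of_lt ht) f x).symm
  · obtain ⟨K, hK⟩ := hPn 1
    exact ⟨K, 1, one_pos, fun t h0 h1 => hK t ⟨h0, h1⟩⟩
  · rw [hP t ht]; exact hf _

end Feller

/-- Banach–Alaoglu: for `R ≥ 1` the sublevel set is the trace on the closed set `E` of a ball of
radius `√(R - 1)`. -/
theorem isAdmissibleWeight_weight {Y : Type*} [NormedAddCommGroup Y] [NormedSpace ℝ Y]
    {E : Set (WeakDual ℝ Y)} (hE : IsClosed E) : IsAdmissibleWeight (weight E) := by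
  intro R _
  have h1 := hE.isClosedEmbedding_subtypeVal.isCompact_preimage
    (WeakDual.isCompact_closedBall (0 : StrongDual ℝ Y) (Real.sqrt (R - 1)))
  have h2 : {x : E | (weight E x : ℝ) ≤ R} ⊆ Subtype.val ⁻¹'
      (WeakDual.toStrongDual ⁻¹' Metric.closedBall (0 : StrongDual ℝ Y) (Real.sqrt (R - 1))) := by
    intro x hx
    have hx' : 1 + ‖WeakDual.toStrongDual (x : WeakDual ℝ Y)‖ ^ 2 ≤ R := hx
    simp only [mem_preimage, mem_closedBall_zero_iff]
    exact Real.le_sqrt_of_sq_le (by linarith)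
  -- For `R < 1` the sublevel set is empty, whereas `Real.sqrt (R - 1) = 0` still gives a ball
  -- containing `0`.
  by_cases hR : 0 ≤ R - 1
  · convert h1 using 1
    refine Subset.antisymm h2 fun x hx => ?_
    simp only [mem_preimage, mem_closedBall_zero_iff] at hx
    have := (Real.le_sqrt (norm_nonneg _) hR).1 hx
    change 1 + ‖WeakDual.toStrongDual (x : WeakDual ℝ Y)‖ ^ 2 ≤ R
    linarith
  · convert isCompact_empty
    refine eq_empty_of_forall_notMem fun x hx => ?_
    have hx' : 1 + ‖WeakDual.toStrongDual (x : WeakDual ℝ Y)‖ ^ 2 ≤ R := hx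
    nlinarith [sq_nonneg ‖WeakDual.toStrongDual (x : WeakDual ℝ Y)‖]

/-! ### Invariance of the cone and the Feller semigroup on it -/

theorem mainTheorem9 {Z Y : Type*}
    [NormedAddCommGroup Z] [NormedSpace ℝ Z] [CompleteSpace Z]
    [NormedAddCommGroup Y] [NormedSpace ℝ Y] [CompleteSpace Y]
    (ι : Z →L[ℝ] Y)
    (SY : ℝ → StrongDual ℝ Y →L[ℝ] StrongDual ℝ Y)
    (SZ : ℝ → StrongDual ℝ Z →L[ℝ] StrongDual ℝ Z)
    (ν : StrongDual ℝ Z) (g : Y)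
    (hsetting : IsLiftSetting ι SY SZ)
    (hreg : IsRegularizing ι SZ ν)
    (hcrucial : ∀ u : ℝ, 0 < u → ∀ w : ℝ, 0 < w →
      StrongDual.toWeakDual (damped ι SZ ν u) ∈ coneEw ι SY SZ ν g w) :
    -- the set `𝓔` is a weak-* closed convex cone, and `(𝓔, ρ)` is a weighted space
    (IsClosed (coneE ι SY SZ ν g) ∧ Convex ℝ (coneE ι SY SZ ν g) ∧
      0 ∈ coneE ι SY SZ ν g ∧
      (∀ c : ℝ, 0 < c → ∀ l ∈ coneE ι SY SZ ν g, c • l ∈ coneE ι SY SZ ν g) ∧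
      IsAdmissibleWeight (weight (coneE ι SY SZ ν g))) ∧
    -- it contains all `S*_t ν`, `t > 0`
    (∀ t : ℝ, 0 < t → StrongDual.toWeakDual (damped ι SZ ν t) ∈ coneE ι SY SZ ν g) ∧
    ∀ w : ℝ, 0 < w →
      -- the equation has a unique mild solution for every initial value in `Y*`
      (∀ l₀ : StrongDual ℝ Y, ∃ l : ℝ → StrongDual ℝ Y,
        IsMildSolution ι SY SZ ν g w l₀ l ∧
        ∀ l' : ℝ → StrongDual ℝ Y, IsMildSolution ι SY SZ ν g w l₀ l' → EqOn l' l (Ici 0)) ∧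
      -- the solution leaves `𝓔` invariant
      (∀ (l₀ : StrongDual ℝ Y) (l : ℝ → StrongDual ℝ Y),
        StrongDual.toWeakDual l₀ ∈ coneE ι SY SZ ν g → IsMildSolution ι SY SZ ν g w l₀ l →
        ∀ t : ℝ, 0 ≤ t → StrongDual.toWeakDual (l t) ∈ coneE ι SY SZ ν g) ∧
      -- `P_t f (λ_0) = f (λ_t)` defines a generalized Feller semigroup on `𝓑^ρ(𝓔)`
      ∃ P : ℝ → Brho (weight (coneE ι SY SZ ν g)) →ₗ[ℝ] Brho (weight (coneE ι SY SZ ν g)),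
        IsGeneralizedFellerSemigroup (weight (coneE ι SY SZ ν g)) P ∧
        ∀ (l₀ : coneE ι SY SZ ν g) (l : ℝ → StrongDual ℝ Y),
          IsMildSolution ι SY SZ ν g w (WeakDual.toStrongDual (l₀ : WeakDual ℝ Y)) l →
          ∀ (t : ℝ), 0 ≤ t →
            ∀ (hmem : StrongDual.toWeakDual (l t) ∈ coneE ι SY SZ ν g)
              (f : Brho (weight (coneE ι SY SZ ν g))),
              (P t f : coneE ι SY SZ ν g → ℝ) l₀ =
                (f : coneE ι SY SZ ν g → ℝ) ⟨StrongDual.toWeakDual (l t), hmem⟩ := by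
  obtain ⟨T, hD⟩ := exists_isAdjointOrbit hsetting hreg
  choose G hG using hD.exists_dualSolution g
  have hmemw : ∀ (w : ℝ) (l : WeakDual ℝ Y),
      l ∈ coneEw ι SY SZ ν g w ↔ ∀ t : ℝ, 0 ≤ t → 0 ≤ l (G w t) := fun w l =>
    mem_coneEw_iff hD (hG w) l
  have hmem : ∀ l : WeakDual ℝ Y, l ∈ coneE ι SY SZ ν g ↔
      ∀ w : ℝ, 0 < w → ∀ t : ℝ, 0 ≤ t → 0 ≤ l (G w t) := by
    intro l
    simp only [coneE, mem_iInter, mem_Ioi, hmemw]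
  have hpos : ∀ w : ℝ, 0 < w → ∀ u : ℝ, 0 < u → ∀ t : ℝ, 0 ≤ t →
      0 ≤ damped ι SZ ν u (G w t) := fun w hw u hu =>
    (hmemw w _).1 (hcrucial u hu w hw)
  have hclosed : IsClosed (coneE ι SY SZ ν g) := by
    have : coneE ι SY SZ ν g =
        ⋂ (w : ℝ) (_ : 0 < w) (t : ℝ) (_ : 0 ≤ t), {l : WeakDual ℝ Y | 0 ≤ l (G w t)} := by
      ext l
      simp only [hmem, mem_iInter, mem_ofPred_eq]
    rw [this]
    exact isClosed_iInter fun w => isClosed_iInter fun _ => isClosed_iInter fun t =>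
      isClosed_iInter fun _ => isClosed_le continuous_const (WeakDual.eval_continuous _)
  have hinv : ∀ w : ℝ, 0 < w → ∀ l : WeakDual ℝ Y, l ∈ coneE ι SY SZ ν g → ∀ t : ℝ, 0 ≤ t →
      StrongDual.toWeakDual (mildFlow SY (damped ι SZ ν) w (G w) (WeakDual.toStrongDual l) t) ∈
        coneE ι SY SZ ν g := by
    intro w hw l hl t ht
    rw [hmem] at hl ⊢
    intro w' hw' τ hτ
    -- For `w ≤ w'`, variation of constants keeps the solution in the larger coefficient's cone. For
    -- `w' ≤ w`, the solution stays in its own cone for `w`, which lies in the one for `w'`.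
    rcases le_total w w' with h | h
    · exact nonneg_mildFlow_dualSolution_of_le hD (hG w) (hG w') h (hpos w' hw')
        (l := WeakDual.toStrongDual l) (hl w hw) (hl w' hw') ht hτ
    · refine nonneg_dualSolution_of_le hD (hG w) (hG w') h (hpos w' hw')
        (l := mildFlow SY (damped ι SZ ν) w (G w) (WeakDual.toStrongDual l) t) ?_ hτ
      intro s hs
      rw [mildFlow_apply_dualSolution hD (hG w) _ ht hs]
      exact hl w hw _ (add_nonneg ht hs)
  refine ⟨⟨hclosed, ?_, ?_, ?_, isAdmissibleWeight_weight hclosed⟩, fun t ht => ?_,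
    fun w hw => ⟨fun l₀ => ?_, fun l₀ l hl₀ hl t ht => ?_, ?_⟩⟩
  · intro l hl m hm a b ha hb _
    rw [hmem] at hl hm ⊢
    intro w hw t ht
    exact add_nonneg (mul_nonneg ha (hl w hw t ht)) (mul_nonneg hb (hm w hw t ht))
  · exact (hmem 0).2 fun w _ t _ => le_rfl
  · intro c hc l hl
    rw [hmem] at hl ⊢
    exact fun w hw t ht => mul_nonneg hc.le (hl w hw t ht)
  · exact (hmem _).2 fun w hw => hpos w hw t ht
  · exact ⟨_, isMildSolution_mildFlow hD (hG w) l₀, fun l' hl' => hl'.eqOn_mildFlow hD (hG w)⟩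
  · rw [hl.eqOn_mildFlow hD (hG w) (mem_Ici.2 ht)]
    exact hinv w hw _ hl₀ t ht
  · set Φ : ℝ → coneE ι SY SZ ν g → coneE ι SY SZ ν g := fun t x =>
      ⟨StrongDual.toWeakDual (mildFlow SY (damped ι SZ ν) w (G w)
        (WeakDual.toStrongDual (x : WeakDual ℝ Y)) (max t 0)),
        hinv w hw _ x.2 _ (le_max_right _ _)⟩ with hΦ
    have hΦv : ∀ t : ℝ, 0 ≤ t → ∀ x, (Φ t x : WeakDual ℝ Y) =
        StrongDual.toWeakDual (mildFlow SY (damped ι SZ ν) w (G w)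
          (WeakDual.toStrongDual (x : WeakDual ℝ Y)) t) := by
      intro t ht x
      rw [hΦ]
      simp only [max_eq_left ht]
    have hzero : ∀ x, Φ 0 x = x := by
      intro x
      refine Subtype.ext ?_
      rw [hΦv 0 le_rfl, mildFlow_zero hD]
      rfl
    have hadd : ∀ s t : ℝ, 0 ≤ s → 0 ≤ t → ∀ x, Φ (t + s) x = Φ s (Φ t x) := by
      intro s t hs ht x
      refine Subtype.ext ?_
      rw [hΦv _ (add_nonneg ht hs), hΦv s hs, hΦv t ht, ← mildFlow_add hD (hG w) _ ht hs]
      rfl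
    have hcont : ∀ t : ℝ, 0 ≤ t → Continuous (Φ t) := by
      intro t ht
      refine Continuous.subtype_mk ?_ _
      exact (continuous_mildFlow_weakDual hD (hG w) (le_max_right t 0)).comp continuous_subtype_val
    have hgrowth : ∀ a : ℝ, ∃ C : ℝ, 0 < C ∧ ∀ t ∈ Icc 0 a, ∀ x,
        (weight (coneE ι SY SZ ν g) (Φ t x) : ℝ) ≤ C * weight (coneE ι SY SZ ν g) x := by
      intro a
      obtain ⟨C, hC0, hC⟩ := norm_mildFlow_le hD (hG w) a
      -- From `‖λ_t‖ ≤ C ‖λ_0‖`: `1 + C² ‖λ_0‖² ≤ (1 + C²)(1 + ‖λ_0‖²)`.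
      refine ⟨1 + C ^ 2, by positivity, fun t ht x => ?_⟩
      have h1 := hC (WeakDual.toStrongDual (x : WeakDual ℝ Y)) t ht
      have h2 : ((weight (coneE ι SY SZ ν g) (Φ t x) : Ioi (0 : ℝ)) : ℝ) =
          1 + ‖mildFlow SY (damped ι SZ ν) w (G w)
            (WeakDual.toStrongDual (x : WeakDual ℝ Y)) t‖ ^ 2 := by
        rw [weight]
        simp only [hΦv t ht.1]
        rfl
      have h3 : ((weight (coneE ι SY SZ ν g) x : Ioi (0 : ℝ)) : ℝ) =
          1 + ‖WeakDual.toStrongDual (x : WeakDual ℝ Y)‖ ^ 2 := rfl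
      rw [h2, h3]
      have h4 := pow_le_pow_left₀ (norm_nonneg _) h1 2
      rw [mul_pow] at h4
      nlinarith [sq_nonneg C, sq_nonneg ‖WeakDual.toStrongDual (x : WeakDual ℝ Y)‖]
    have htend : ∀ x, Tendsto (fun t => Φ t x) (𝓝[>] 0) (𝓝 x) := by
      intro x
      have h1 : Tendsto (mildFlow SY (damped ι SZ ν) w (G w)
          (WeakDual.toStrongDual (x : WeakDual ℝ Y))) (𝓝[>] 0)
          (𝓝 (WeakDual.toStrongDual (x : WeakDual ℝ Y))) := by
        have h := (continuousOn_mildFlow hD (hG w)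
          (WeakDual.toStrongDual (x : WeakDual ℝ Y))) 0 (mem_Ici.2 le_rfl)
        rw [ContinuousWithinAt, mildFlow_zero hD] at h
        exact h.mono_left (nhdsWithin_mono _ Ioi_subset_Ici_self)
      have h2 := (NormedSpace.Dual.toWeakDual_continuous.tendsto _).comp h1
      rw [tendsto_subtype_rng]
      refine Tendsto.congr' ?_ h2
      exact eventually_nhdsWithin_of_forall fun t ht => (hΦv t (le_of_lt ht) x).symm
    obtain ⟨P, hP, hPΦ⟩ := exists_generalizedFellerSemigroup_of_flow
      (ρ := weight (coneE ι SY SZ ν g)) Φ hzero hadd hcont hgrowth htend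
    refine ⟨P, hP, fun l₀ l hl t ht hmem' f => ?_⟩
    rw [hPΦ t ht]
    refine congrArg (f : coneE ι SY SZ ν g → ℝ) (Subtype.ext ?_)
    rw [hΦv t ht, ← hl.eqOn_mildFlow hD (hG w) (mem_Ici.2 ht)]
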